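/- Let $k$ be an algebraically closed field and let $C=C_0\oplus C_1$ be a $\mathbb Z_2$-graded coalgebra over $k$ (comultiplication and counit homogeneous of degree $0$). Comodules are $\mathbb Z_2$-graded right $C$-comodules $W=W_0\oplus W_1$ with structure map $W\to W\otimes C$ of degree $0$; their homomorphisms are the comodule maps of degree $0$, and "simple", "indecomposable", "injective" refer to graded subcomodules and degree-$0$ maps. A comodule is injective if it is a direct summand of every comodule that contains it. A simple comodule is absolutely simple if it has no proper nonzero subcomodule even when non-graded subcomodules are allowed. Let $\sigma(W)$ be the socle of $W$ (the sum of its simple subcomodules), $\sigma(W)_j=\sigma(W)\cap W_j$, and let $W'$ be $W$ with its grading reversed, $W'_j=W_{j+1}$. Call a family $\hat F$ of indecomposable injective comodules with simple socles a full family of injective covers modulo grading if every simple comodule is isomorphic, after forgetting gradings, to $\sigma(I)$ for exactly one member $I$ of $\hat F$. Let $\hat F_1$ consist of those $I\in\hat F$ for which $\sigma(I)$ is absolutely simple, and let $\hat F_2$ consist of the others. (1) Such families exist, and the members can be chosen so that each is isomorphic to a (graded) subcomodule of $C$. (2) For every such family $\hat F$, each $\sigma(I)$ with $I\in\hat F$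 is finite dimensional, $\dim\sigma(I)$ is even for $I\in\hat F_2$, and as graded comodules $$C\;\simeq\;\bigoplus_{I\in\hat F_1}\bigl(\dim(\sigma(I)_0)\, I\oplus \dim(\sigma(I)_1)\, I'\bigr)\;\oplus\;\bigoplus_{I\in\hat F_2}\tfrac12\dim(\sigma(I))\, I ,$$ where $m\,I$ denotes the direct sum of $m$ copies of $I$. (3) Up to isomorphism, the gradings of an indecomposable injective comodule $I$ are exactly its given one and the reverse one: the gradings of $I$ and $I'$ are different; every graded comodule $J$ that is isomorphic to $I$ after forgetting gradings is isomorphic, as a graded comodule, to $I$ or to $I'$; and $I\simeq I'$ as graded comodules if and only if $\sigma(I)$ is not absolutely simple. -/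

import Mathlib

open scoped TensorProduct

universe u v w w'

/-- The degree `n` part `⨁_{a + b = n} 𝒱 a ⊗ 𝒲 b` of a tensor product of two `ℤ/2`-graded
vector spaces. -/
def tensorGrading {k : Type u} [Field k] {V : Type v} [AddCommGroup V] [Module k V]
    {W : Type w} [AddCommGroup W] [Module k W]
    (𝒱 : ZMod 2 → Submodule k V) (𝒲 : ZMod 2 → Submodule k W) (n : ZMod 2) :
    Submodule k (V ⊗[k] W) :=
  ⨆ a : ZMod 2, Submodule.map₂ (TensorProduct.mk k V W) (𝒱 a) (𝒲 (n - a))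

/-- `C = 𝒞 0 ⊕ 𝒞 1` is a `ℤ/2`-graded coalgebra: comultiplication and counit are homogeneous of
degree zero (the base field sits in degree `0`). -/
class IsGradedCoalgebra {k : Type u} [Field k] {C : Type v} [AddCommGroup C] [Module k C]
    [Coalgebra k C] (𝒞 : ZMod 2 → Submodule k C) : Prop where
  isCompl : IsCompl (𝒞 0) (𝒞 1)
  comul_mem : ∀ (n : ZMod 2), ∀ x ∈ 𝒞 n,
    (CoalgebraStruct.comul (R := k) x : C ⊗[k] C) ∈ tensorGrading 𝒞 𝒞 n
  counit_eq_zero : ∀ x ∈ 𝒞 1, (CoalgebraStruct.counit x : k) = 0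

/-- A (right, ungraded) comodule over the coalgebra `C`. -/
structure Comodule (k : Type u) [Field k] (C : Type v) [AddCommGroup C] [Module k C]
    [Coalgebra k C] where
  carrier : Type w
  [addCommGroup : AddCommGroup carrier]
  [module : Module k carrier]
  coact : carrier →ₗ[k] carrier ⊗[k] C
  coassoc : (TensorProduct.assoc k carrier C C).toLinearMap ∘ₗ coact.rTensor C ∘ₗ coact =
    (CoalgebraStruct.comul (R := k) (A := C)).lTensor carrier ∘ₗ coact
  counit_coact : (CoalgebraStruct.counit (R := k) (A := C)).lTensor carrier ∘ₗ coact =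
    (TensorProduct.mk k carrier k).flip 1

attribute [instance] Comodule.addCommGroup Comodule.module

namespace Comodule

variable {k : Type u} [Field k] {C : Type v} [AddCommGroup C] [Module k C] [Coalgebra k C]

/-- Homomorphisms of (ungraded) comodules. -/
def IsHom (V : Comodule.{u, v, w} k C) (W : Comodule.{u, v, w'} k C)
    (f : V.carrier →ₗ[k] W.carrier) : Prop :=
  W.coact ∘ₗ f = f.rTensor C ∘ₗ V.coact

/-- Isomorphism of (ungraded) comodules. -/
def Iso (V : Comodule.{u, v, w} k C) (W : Comodule.{u, v, w'} k C) : Prop :=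
  ∃ e : V.carrier ≃ₗ[k] W.carrier, V.IsHom W e.toLinearMap

/-- `N` is a subcomodule: the coaction maps `N` into `N ⊗ C`. -/
def IsSub (V : Comodule.{u, v, w} k C) (N : Submodule k V.carrier) : Prop :=
  ∀ x ∈ N, V.coact x ∈ Submodule.map₂ (TensorProduct.mk k V.carrier C) N ⊤

/-- `V` is isomorphic, as an ungraded comodule, to the subcomodule `N` of `W`. -/
def IsoSub (V : Comodule.{u, v, w} k C) (W : Comodule.{u, v, w'} k C)
    (N : Submodule k W.carrier) : Prop :=
  ∃ f : V.carrier →ₗ[k] W.carrier,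
    V.IsHom W f ∧ Function.Injective f ∧ LinearMap.range f = N

/-- `N` is a subcomodule which is simple in the ungraded sense. -/
def IsSimpleSub (V : Comodule.{u, v, w} k C) (N : Submodule k V.carrier) : Prop :=
  V.IsSub N ∧ N ≠ ⊥ ∧ ∀ N' : Submodule k V.carrier, V.IsSub N' → N' ≤ N → N' = ⊥ ∨ N' = N

end Comodule

/-- A `ℤ/2`-graded (right) comodule over the graded coalgebra `C = 𝒞 0 ⊕ 𝒞 1`. -/
structure GradedComodule {k : Type u} [Field k] {C : Type v} [AddCommGroup C] [Module k C]
    [Coalgebra k C] (𝒞 : ZMod 2 → Submodule k C) extends Comodule.{u, v, w} k C where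
  gr : ZMod 2 → Submodule k carrier
  isCompl : IsCompl (gr 0) (gr 1)
  coact_mem : ∀ (n : ZMod 2), ∀ x ∈ gr n, coact x ∈ tensorGrading gr 𝒞 n

namespace GradedComodule

variable {k : Type u} [Field k] {C : Type v} [AddCommGroup C] [Module k C] [Coalgebra k C]
  {𝒞 : ZMod 2 → Submodule k C}

/-- Homomorphisms of graded comodules, that is comodule homomorphisms of degree zero. -/
def IsHom (V : GradedComodule.{u, v, w} 𝒞) (W : GradedComodule.{u, v, w'} 𝒞)
    (f : V.carrier →ₗ[k] W.carrier) : Prop :=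
  V.toComodule.IsHom W.toComodule f ∧ ∀ (n : ZMod 2), ∀ x ∈ V.gr n, f x ∈ W.gr n

/-- Isomorphism of graded comodules. -/
def Iso (V : GradedComodule.{u, v, w} 𝒞) (W : GradedComodule.{u, v, w'} 𝒞) : Prop :=
  ∃ e : V.carrier ≃ₗ[k] W.carrier, V.IsHom W e.toLinearMap

/-- `V` is isomorphic to a graded subcomodule of `W`. -/
def Embeds (V : GradedComodule.{u, v, w} 𝒞) (W : GradedComodule.{u, v, w'} 𝒞) : Prop :=
  ∃ f : V.carrier →ₗ[k] W.carrier, V.IsHom W f ∧ Function.Injective f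

/-- `N` is a graded subcomodule: a subcomodule spanned by homogeneous elements. -/
def IsSub (V : GradedComodule.{u, v, w} 𝒞) (N : Submodule k V.carrier) : Prop :=
  V.toComodule.IsSub N ∧ N ≤ (N ⊓ V.gr 0) ⊔ (N ⊓ V.gr 1)

/-- `N` is a simple graded subcomodule. -/
def IsSimpleSub (V : GradedComodule.{u, v, w} 𝒞) (N : Submodule k V.carrier) : Prop :=
  V.IsSub N ∧ N ≠ ⊥ ∧ ∀ N' : Submodule k V.carrier, V.IsSub N' → N' ≤ N → N' = ⊥ ∨ N' = N

/-- `N` is an absolutely simple subcomodule: a graded subcomodule which is simple even in the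
ungraded sense. -/
def IsAbsolutelySimpleSub (V : GradedComodule.{u, v, w} 𝒞) (N : Submodule k V.carrier) : Prop :=
  V.IsSub N ∧ V.toComodule.IsSimpleSub N

/-- Simple graded comodules. -/
def IsSimple (V : GradedComodule.{u, v, w} 𝒞) : Prop :=
  V.IsSimpleSub ⊤

/-- The socle: the sum of all simple graded subcomodules. -/
def socle (V : GradedComodule.{u, v, w} 𝒞) : Submodule k V.carrier :=
  sSup {N | V.IsSimpleSub N}

/-- The dimension of the homogeneous part of degree `n` of the socle. -/
noncomputable def socleDim (V : GradedComodule.{u, v, w} 𝒞) (n : ZMod 2) : ℕ :=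
  Module.finrank k ↥(V.socle ⊓ V.gr n)

/-- `V` is nonzero and not a direct sum of two nonzero graded subcomodules. -/
def IsIndecomposable (V : GradedComodule.{u, v, w} 𝒞) : Prop :=
  Nontrivial V.carrier ∧ ∀ N N' : Submodule k V.carrier, V.IsSub N → V.IsSub N' →
    IsCompl N N' → N = ⊥ ∨ N' = ⊥

/-- `V` is injective: it splits from every graded comodule containing it. -/
def IsInjective (V : GradedComodule.{u, v, w} 𝒞) : Prop :=
  ∀ (W : GradedComodule.{u, v, w} 𝒞) (f : V.carrier →ₗ[k] W.carrier), V.IsHom W f →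
    Function.Injective f →
    ∃ r : W.carrier →ₗ[k] V.carrier, W.IsHom V r ∧ r ∘ₗ f = LinearMap.id

/-- `C` as a graded comodule over itself. -/
def regular (𝒞 : ZMod 2 → Submodule k C) [IsGradedCoalgebra 𝒞] : GradedComodule.{u, v, v} 𝒞 where
  carrier := C
  coact := CoalgebraStruct.comul
  coassoc := Coalgebra.coassoc
  counit_coact := Coalgebra.lTensor_counit_comp_comul
  gr := 𝒞
  isCompl := IsGradedCoalgebra.isCompl
  coact_mem := IsGradedCoalgebra.comul_mem

/-- `V'`: the comodule `V` with its grading reversed. -/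
def reverse (V : GradedComodule.{u, v, w} 𝒞) : GradedComodule.{u, v, w} 𝒞 where
  toComodule := V.toComodule
  gr n := V.gr (n + 1)
  isCompl := by
    have h : (1 + 1 : ZMod 2) = 0 := by decide
    simpa [h] using V.isCompl.symm
  coact_mem n x hx := by
    have h := V.coact_mem _ x hx
    refine (iSup_le fun a => ?_ : tensorGrading V.gr 𝒞 (n + 1) ≤ _) h
    refine le_iSup_of_le (a - 1) ?_
    have h1 : a - 1 + 1 = a := sub_add_cancel a 1
    have h2 : n - (a - 1) = n + 1 - a := by ring
    simp only [h1, h2, le_refl]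

open scoped Classical in
/-- The coaction of the direct sum of a family of comodules. -/
noncomputable def directSumCoact {ι : Type w'} (W : ι → GradedComodule.{u, v, w} 𝒞) :
    (DirectSum ι fun i => (W i).carrier) →ₗ[k]
      (DirectSum ι fun i => (W i).carrier) ⊗[k] C :=
  DirectSum.toModule k ι _ fun i =>
    (DirectSum.lof k ι (fun i => (W i).carrier) i).rTensor C ∘ₗ (W i).coact

open scoped Classical in
theorem directSumCoact_comp_lof {ι : Type w'} (W : ι → GradedComodule.{u, v, w} 𝒞) (i : ι) :
    directSumCoact W ∘ₗ DirectSum.lof k ι (fun i => (W i).carrier) i =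
      (DirectSum.lof k ι (fun i => (W i).carrier) i).rTensor C ∘ₗ (W i).coact := by
  ext x
  simp [directSumCoact, DirectSum.toModule_lof]

open scoped Classical in
/-- The direct sum of a family of graded comodules. -/
noncomputable def directSum {ι : Type w'} (W : ι → GradedComodule.{u, v, w} 𝒞) :
    GradedComodule.{u, v, max w' w} 𝒞 where
  carrier := DirectSum ι fun i => (W i).carrier
  coact := directSumCoact W
  coassoc := by
    refine DirectSum.linearMap_ext k fun i => ?_
    have hb := directSumCoact_comp_lof W i
    have hc := (W i).coassoc
    set l := DirectSum.lof k ι (fun i => (W i).carrier) i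
    calc _ = (TensorProduct.assoc k _ C C).toLinearMap ∘ₗ (directSumCoact W).rTensor C ∘ₗ
          (directSumCoact W ∘ₗ l) := rfl
      _ = (TensorProduct.assoc k _ C C).toLinearMap ∘ₗ
          ((directSumCoact W).rTensor C ∘ₗ l.rTensor C) ∘ₗ (W i).coact := by rw [hb]; rfl
      _ = ((TensorProduct.assoc k _ C C).toLinearMap ∘ₗ (l.rTensor C).rTensor C) ∘ₗ
          (W i).coact.rTensor C ∘ₗ (W i).coact := by
        rw [← LinearMap.rTensor_comp, hb, LinearMap.rTensor_comp]; rfl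
      _ = l.rTensor (C ⊗[k] C) ∘ₗ ((TensorProduct.assoc k _ C C).toLinearMap ∘ₗ
          (W i).coact.rTensor C ∘ₗ (W i).coact) := by
        have ha : (TensorProduct.assoc k _ C C).toLinearMap ∘ₗ (l.rTensor C).rTensor C =
            l.rTensor (C ⊗[k] C) ∘ₗ (TensorProduct.assoc k _ C C).toLinearMap :=
          TensorProduct.ext_threefold fun x y z => by simp
        rw [ha]
        rfl
      _ = (l.rTensor (C ⊗[k] C) ∘ₗ (CoalgebraStruct.comul (R := k) (A := C)).lTensor _) ∘ₗ
          (W i).coact := by rw [hc]; rfl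
      _ = (CoalgebraStruct.comul (R := k) (A := C)).lTensor _ ∘ₗ
          (l.rTensor C ∘ₗ (W i).coact) := by
        rw [LinearMap.rTensor_comp_lTensor, ← LinearMap.lTensor_comp_rTensor]; rfl
      _ = _ := by rw [← hb]; rfl
  counit_coact := by
    refine DirectSum.linearMap_ext k fun i => ?_
    have hb := directSumCoact_comp_lof W i
    have hc := (W i).counit_coact
    set l := DirectSum.lof k ι (fun i => (W i).carrier) i
    rw [LinearMap.comp_assoc, hb, ← LinearMap.comp_assoc, LinearMap.lTensor_comp_rTensor,
      ← LinearMap.rTensor_comp_lTensor, LinearMap.comp_assoc, hc]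
    ext x
    simp
  gr n := ⨆ i, ((W i).gr n).map (DirectSum.lof k ι (fun i => (W i).carrier) i)
  isCompl := by
    constructor
    · rw [Submodule.disjoint_def]
      have key : ∀ (n : ZMod 2) (x : DirectSum ι fun i => (W i).carrier),
          x ∈ ⨆ i, ((W i).gr n).map (DirectSum.lof k ι (fun i => (W i).carrier) i) →
          ∀ j, x j ∈ (W j).gr n := by
        intro n x hx j
        have : (⨆ i, ((W i).gr n).map (DirectSum.lof k ι (fun i => (W i).carrier) i)) ≤
            ((W j).gr n).comap (DirectSum.component k ι (fun i => (W i).carrier) j) := by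
          refine iSup_le fun i => ?_
          rintro _ ⟨y, hy, rfl⟩
          rw [Submodule.mem_comap]
          by_cases h : i = j
          · subst h
            rw [DirectSum.component.lof_self]
            exact hy
          · rw [DirectSum.component.of, dif_neg h]
            exact Submodule.zero_mem _
        exact this hx
      intro x h0 h1
      refine DFinsupp.ext fun j => ?_
      exact Submodule.disjoint_def.1 (W j).isCompl.disjoint _ (key 0 x h0 j) (key 1 x h1 j)
    · rw [codisjoint_iff, ← iSup_sup_eq, eq_top_iff]
      intro x _
      induction x using DirectSum.induction_on with
      | zero => exact Submodule.zero_mem _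
      | add x y hx hy => exact Submodule.add_mem _ (hx trivial) (hy trivial)
      | of i y =>
        refine Submodule.mem_iSup_of_mem i ?_
        rw [← Submodule.map_sup, (W i).isCompl.sup_eq_top]
        exact ⟨y, trivial, rfl⟩
  coact_mem n x hx := by
    have : (⨆ i, ((W i).gr n).map (DirectSum.lof k ι (fun i => (W i).carrier) i)) ≤
        (tensorGrading (fun n => ⨆ i, ((W i).gr n).map
          (DirectSum.lof k ι (fun i => (W i).carrier) i)) 𝒞 n).comap (directSumCoact W) := by
      refine iSup_le fun i => ?_
      rintro _ ⟨y, hy, rfl⟩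
      have hb := LinearMap.congr_fun (directSumCoact_comp_lof W i) y
      rw [Submodule.mem_comap]
      simp only [LinearMap.comp_apply] at hb
      rw [hb]
      have hle : tensorGrading (W i).gr 𝒞 n ≤ (tensorGrading (fun n => ⨆ i, ((W i).gr n).map
          (DirectSum.lof k ι (fun i => (W i).carrier) i)) 𝒞 n).comap
          ((DirectSum.lof k ι (fun i => (W i).carrier) i).rTensor C) := by
        refine iSup_le fun a => Submodule.map₂_le.2 fun p hp c hc => ?_
        rw [Submodule.mem_comap]
        refine Submodule.mem_iSup_of_mem a ?_
        exact Submodule.apply_mem_map₂ _ (Submodule.mem_iSup_of_mem i ⟨p, hp, rfl⟩) hc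
      exact hle ((W i).coact_mem n y hy)
    exact this hx

/-- A full family of injective covers of the simple graded comodules modulo their grading: the
members are indecomposable injectives with simple socle, and for each simple graded comodule `S`
there is exactly one member whose socle is isomorphic to `S` when gradings are forgotten. -/
structure IsCoverFamily {ι : Type w'} (I : ι → GradedComodule.{u, v, w} 𝒞) : Prop where
  indecomposable : ∀ i, (I i).IsIndecomposable
  injective : ∀ i, (I i).IsInjective
  socle_simple : ∀ i, (I i).IsSimpleSub (I i).socle
  existsUnique : ∀ S : GradedComodule.{u, v, w} 𝒞, S.IsSimple →
    ∃! i, S.toComodule.IsoSub (I i).toComodule (I i).socle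

/-- The members of the family with absolutely simple socle. -/
abbrev Abs {ι : Type w'} (I : ι → GradedComodule.{u, v, w} 𝒞) : Type w' :=
  {i : ι // (I i).IsAbsolutelySimpleSub (I i).socle}

/-- The members of the family whose socle is not absolutely simple. -/
abbrev NonAbs {ι : Type w'} (I : ι → GradedComodule.{u, v, w} 𝒞) : Type w' :=
  {i : ι // ¬ (I i).IsAbsolutelySimpleSub (I i).socle}

/-- The indices of the summands of `decomposition`. -/
abbrev SummandIndex {ι : Type w'} (I : ι → GradedComodule.{u, v, w} 𝒞) : Type w' :=
  (Σ i : Abs I, Fin ((I i.1).socleDim 0) ⊕ Fin ((I i.1).socleDim 1)) ⊕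
    (Σ i : NonAbs I, Fin (Module.finrank k ↥(I i.1).socle / 2))

/-- The summands of `decomposition`. -/
def summand {ι : Type w'} (I : ι → GradedComodule.{u, v, w} 𝒞) :
    SummandIndex I → GradedComodule.{u, v, w} 𝒞
  | Sum.inl ⟨i, Sum.inl _⟩ => I i.1
  | Sum.inl ⟨i, Sum.inr _⟩ => (I i.1).reverse
  | Sum.inr ⟨i, _⟩ => I i.1

/-- The direct sum, over the members `I` with absolutely simple socle, of `dim σ(I)₀` copies of
`I` and `dim σ(I)₁` copies of `I'`, and, over the other members `I`, of `½ dim σ(I)` copies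
of `I`. -/
noncomputable def decomposition {ι : Type w'} (I : ι → GradedComodule.{u, v, w} 𝒞) :
    GradedComodule.{u, v, max w' w} 𝒞 :=
  directSum (summand I)

end GradedComodule

-- A functional `f` on `C` acts on a comodule by contracting the coaction with `f`. Contractions
-- separate the points of `V ⊗ C`, so comodule maps and subcomodules are the maps and subspaces
-- compatible with this action. In the graded case one also asks for compatibility with the two
-- projections, and a functional of degree `m` shifts degrees by `m`. Orbits are finite dimensional,
-- so every nonzero graded subcomodule contains a finite-dimensional simple one.
--
-- Injectivity is handled through `CoactSplits`: the coaction `V → V ⊗ C` into the cofree comodule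
-- has a retraction. This gives extension of maps in every universe
-- (`CoactSplits.exists_extension`), passes to retracts, reversals and arbitrary direct sums, and
-- holds for `C`. Zorn's lemma then gives injective hulls as direct summands
-- (`CoactSplits.exists_hull`). Hulls inside `C` of representatives of its simple subcomodules form
-- a cover family, and an indecomposable injective is an essential extension of its simple socle.
--
-- Simplicity and forgetting gradings: a proper nonzero nongraded subcomodule of a simple `V`
-- provides a symmetry exchanging degrees, so `V ≃ V'`. Conversely, an isomorphism `u : V → V'` has
-- scalar square `d²` by Schur's lemma, and `u - d` has a kernel that is neither zero nor
-- everything. Hence not absolutely simple means isomorphic to its reverse. An ungraded isomorphism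
-- out of an indecomposable injective splits into an even and an odd part; one of them is injective
-- on the socle, hence injective, hence split, and the splitting is bijective by a
-- finite-dimensional count on the ungraded socle.
--
-- Decomposition: composition with the counit identifies degree-0 maps `V → C` with functionals
-- killing `V₁`. A simple `S` therefore has a `dim S₀`-dimensional space of maps to `C`, and its
-- reverse one of dimension `dim S₁`. If `S ≃ S'` these are the same comodule and both numbers are
-- half of `dim S`. On the proposed sum a functional is chosen that restricts to dual bases of the
-- degree-0 socles of the copies. The corresponding map to `C` is injective because it is so on
-- simple subcomodules, it splits because the sum is injective, and its image contains every simple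
-- subcomodule of `C`, so no complement is left.

universe w''

/-! ### Contraction of a tensor product with functionals -/

section Slice

variable {k : Type*} [Field k] {C C' V W : Type*} [AddCommGroup C] [Module k C]
  [AddCommGroup C'] [Module k C'] [AddCommGroup V] [Module k V] [AddCommGroup W] [Module k W]

/-- Contraction of the right tensor factor with a linear functional. -/
noncomputable def slice (f : Module.Dual k C) : V ⊗[k] C →ₗ[k] V :=
  (TensorProduct.rid k V).toLinearMap ∘ₗ f.lTensor V

@[simp]
theorem slice_tmul (f : Module.Dual k C) (v : V) (c : C) : slice f (v ⊗ₜ[k] c) = f c • v := by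
  simp [slice]

theorem slice_rTensor (f : Module.Dual k C) (g : V →ₗ[k] W) (z : V ⊗[k] C) :
    slice f (g.rTensor C z) = g (slice f z) := by
  induction z with
  | zero => simp
  | tmul v c => simp
  | add x y hx hy => simp [hx, hy]

theorem slice_lTensor (f : Module.Dual k C') (h : C →ₗ[k] C') (z : V ⊗[k] C) :
    slice f (h.lTensor V z) = slice (f ∘ₗ h) z := by
  induction z with
  | zero => simp
  | tmul v c => simp
  | add x y hx hy => simp only [map_add, hx, hy]

theorem slice_add (f g : Module.Dual k C) (z : V ⊗[k] C) :
    slice (f + g) z = slice f z + slice g z := by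
  simp [slice, LinearMap.lTensor_add]

theorem slice_smul (a : k) (f : Module.Dual k C) (z : V ⊗[k] C) :
    slice (a • f) z = a • slice f z := by
  simp [slice, LinearMap.lTensor_smul]

theorem mem_map₂_top_iff {N : Submodule k V} {z : V ⊗[k] C} :
    z ∈ Submodule.map₂ (TensorProduct.mk k V C) N ⊤ ↔ ∀ f : Module.Dual k C, slice f z ∈ N := by
  constructor
  · intro h f
    refine (Submodule.map₂_le.2 ?_ : _ ≤ N.comap (slice f)) h
    intro v hv c _
    simpa using N.smul_mem _ hv
  · intro h
    -- Expanding `z` along a basis of `C`, the left-hand coefficients are exactly the contractions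
    -- with the coordinate functionals.
    let b := Module.Basis.ofVectorSpace k C
    obtain ⟨s, rfl⟩ := TensorProduct.eq_repr_basis_right b z
    refine Submodule.sum_mem _ fun i _ => Submodule.apply_mem_map₂ _ ?_ trivial
    have := h (b.coord i)
    rw [Finsupp.sum, map_sum, Finset.sum_eq_single i] at this
    · simpa using this
    · intro j _ hj
      simp [hj]
    · intro h'
      simp [Finsupp.notMem_support_iff.1 h']

theorem slice_ext {z z' : V ⊗[k] C} (h : ∀ f : Module.Dual k C, slice f z = slice f z') :
    z = z' := by
  have : z - z' ∈ Submodule.map₂ (TensorProduct.mk k V C) ⊥ ⊤ :=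
    mem_map₂_top_iff.2 fun f => by simp [h f]
  rw [Submodule.map₂_bot_left] at this
  exact sub_eq_zero.1 this

end Slice

/-! ### Gradings by `ZMod 2` and their tensor products -/

section Grading

variable {k : Type*} [Field k] {C V : Type*} [AddCommGroup C] [Module k C]
  [AddCommGroup V] [Module k V] {𝒱 : ZMod 2 → Submodule k V} {𝒞 : ZMod 2 → Submodule k C}

theorem ZMod.two_add_self (n : ZMod 2) : n + n = 0 := by
  revert n; decide

theorem ZMod.two_eq_or (m n : ZMod 2) : m = n ∨ m = n + 1 := by
  revert m n; decide

theorem isCompl_add_one (h : IsCompl (𝒱 0) (𝒱 1)) (n : ZMod 2) : IsCompl (𝒱 n) (𝒱 (n + 1)) := by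
  rcases ZMod.two_eq_or n 0 with rfl | rfl
  · simpa using h
  · simpa [show (1 + 1 : ZMod 2) = 0 by decide] using h.symm

/-- The projection of a `ℤ/2`-graded vector space onto its part of degree `n`. -/
noncomputable def homProj (h : IsCompl (𝒱 0) (𝒱 1)) (n : ZMod 2) : V →ₗ[k] V :=
  (𝒱 n).projection (𝒱 (n + 1)) (isCompl_add_one h n)

theorem homProj_mem (h : IsCompl (𝒱 0) (𝒱 1)) (n : ZMod 2) (x : V) : homProj h n x ∈ 𝒱 n :=
  Submodule.projection_apply_mem _ _

theorem homProj_of_mem (h : IsCompl (𝒱 0) (𝒱 1)) {n : ZMod 2} {x : V} (hx : x ∈ 𝒱 n) :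
    homProj h n x = x :=
  Submodule.projection_apply_of_mem_left _ hx

theorem homProj_of_mem_add_one (h : IsCompl (𝒱 0) (𝒱 1)) {n : ZMod 2} {x : V}
    (hx : x ∈ 𝒱 (n + 1)) : homProj h n x = 0 :=
  (Submodule.projection_apply_eq_zero_iff _).2 hx

theorem homProj_add_one_of_mem (h : IsCompl (𝒱 0) (𝒱 1)) {n : ZMod 2} {x : V}
    (hx : x ∈ 𝒱 n) : homProj h (n + 1) x = 0 :=
  homProj_of_mem_add_one h (by simpa [add_assoc, ZMod.two_add_self] using hx)

theorem homProj_add (h : IsCompl (𝒱 0) (𝒱 1)) (n : ZMod 2) (x : V) :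
    homProj h n x + homProj h (n + 1) x = x := by
  obtain ⟨y, hy, z, hz, rfl⟩ : ∃ y ∈ 𝒱 n, ∃ z ∈ 𝒱 (n + 1), y + z = x :=
    Submodule.mem_sup.1 ((isCompl_add_one h n).sup_eq_top ▸ trivial)
  rw [map_add, map_add, homProj_of_mem h hy, homProj_of_mem h hz, homProj_of_mem_add_one h hz,
    homProj_add_one_of_mem h hy]
  simp

theorem homProj_zero_add_one (h : IsCompl (𝒱 0) (𝒱 1)) (x : V) :
    homProj h 0 x + homProj h 1 x = x := by
  simpa using homProj_add h 0 x

/-- Degrees in `V ⊗ C` can be tested by contracting with homogeneous functionals. This turns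
homogeneity of a coaction into the rule that a functional of degree `m` shifts degrees by `m`. -/
theorem mem_tensorGrading_iff (hC : IsCompl (𝒞 0) (𝒞 1))
    {n : ZMod 2} {z : V ⊗[k] C} :
    z ∈ tensorGrading 𝒱 𝒞 n ↔ ∀ (m : ZMod 2) (f : Module.Dual k C),
      𝒞 (m + 1) ≤ LinearMap.ker f → slice f z ∈ 𝒱 (n + m) := by
  constructor
  · intro h m f hf
    refine (iSup_le fun a => Submodule.map₂_le.2 ?_ :
      tensorGrading 𝒱 𝒞 n ≤ (𝒱 (n + m)).comap (slice f)) h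
    intro v hv c hc
    rw [Submodule.mem_comap, TensorProduct.mk_apply, slice_tmul]
    rcases ZMod.two_eq_or a (n + m) with rfl | rfl
    · exact Submodule.smul_mem _ _ hv
    · have : f c = 0 := hf (by
        rwa [show n - (n + m + 1) = m + 1 by clear * -; revert n m; decide] at hc)
      simp [this]
  · intro h
    -- The component of `z` whose right factor has degree `m` lives in `V ⊗ 𝒞 m`. A functional on `𝒞
    -- m`, composed with the projection, becomes a homogeneous functional on `C`, so the hypothesis
    -- controls all contractions of this component.
    have key (m : ZMod 2) : (homProj hC m).lTensor V z ∈ tensorGrading 𝒱 𝒞 n := by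
      have hz : ((𝒞 m).projectionOnto (𝒞 (m + 1)) (isCompl_add_one hC m)).lTensor V z ∈
          Submodule.map₂ (TensorProduct.mk k V (𝒞 m)) (𝒱 (n + m)) ⊤ := by
        refine mem_map₂_top_iff.2 fun g => ?_
        rw [slice_lTensor]
        refine h m _ fun c hc => ?_
        simp [(Submodule.projectionOnto_apply_eq_zero_iff _).2 hc]
      have e : (homProj hC m).lTensor V z = (𝒞 m).subtype.lTensor V
          (((𝒞 m).projectionOnto (𝒞 (m + 1)) (isCompl_add_one hC m)).lTensor V z) := by
        rw [← LinearMap.comp_apply, ← LinearMap.lTensor_comp]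
        rfl
      rw [e]
      refine (Submodule.map₂_le.2 ?_ : _ ≤
        (tensorGrading 𝒱 𝒞 n).comap ((𝒞 m).subtype.lTensor V)) hz
      intro v hv c _
      refine Submodule.mem_iSup_of_mem (n + m) (Submodule.apply_mem_map₂ _ hv ?_)
      have : n - (n + m) = m := by clear * -; revert n m; decide
      rw [this]
      exact c.2
    have e : z = (homProj hC 0).lTensor V z + (homProj hC 1).lTensor V z := by
      rw [← LinearMap.add_apply, ← LinearMap.lTensor_add]
      have : homProj hC 0 + homProj hC 1 = LinearMap.id :=
        LinearMap.ext (homProj_zero_add_one hC)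
      rw [this]
      simp
    rw [e]
    exact Submodule.add_mem _ (key 0) (key 1)

theorem tmul_mem_tensorGrading {a b n : ZMod 2} (h : n = a + b) {v : V} {c : C} (hv : v ∈ 𝒱 a)
    (hc : c ∈ 𝒞 b) : v ⊗ₜ[k] c ∈ tensorGrading 𝒱 𝒞 n := by
  refine Submodule.mem_iSup_of_mem a (Submodule.apply_mem_map₂ _ hv ?_)
  rwa [h, add_sub_cancel_left]

theorem isCompl_tensorGrading (hV : IsCompl (𝒱 0) (𝒱 1)) (hC : IsCompl (𝒞 0) (𝒞 1)) :
    IsCompl (tensorGrading 𝒱 𝒞 0) (tensorGrading 𝒱 𝒞 1) := by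
  constructor
  · rw [Submodule.disjoint_def]
    intro z h0 h1
    rw [mem_tensorGrading_iff hC] at h0 h1
    have key (m : ZMod 2) (f : Module.Dual k C) (hf : 𝒞 (m + 1) ≤ LinearMap.ker f) :
        slice f z = 0 := by
      refine Submodule.disjoint_def.1 (isCompl_add_one hV m).disjoint _ ?_ ?_
      · simpa using h0 m f hf
      · rw [add_comm]; exact h1 m f hf
    refine slice_ext fun f => ?_
    have e : f = f ∘ₗ homProj hC 0 + f ∘ₗ homProj hC 1 := by
      ext c
      rw [LinearMap.add_apply, LinearMap.comp_apply, LinearMap.comp_apply, ← map_add,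
        homProj_zero_add_one]
    rw [map_zero, e, slice_add, key 0, key 1, add_zero]
    · intro c hc
      rw [LinearMap.mem_ker, LinearMap.comp_apply, homProj_of_mem_add_one hC hc, map_zero]
    · intro c hc
      rw [LinearMap.mem_ker, LinearMap.comp_apply, homProj_of_mem_add_one hC hc, map_zero]
  · rw [codisjoint_iff, eq_top_iff]
    intro z _
    induction z with
    | zero => exact Submodule.zero_mem _
    | add x y hx hy => exact Submodule.add_mem _ (hx trivial) (hy trivial)
    | tmul v c =>
      rw [← homProj_zero_add_one hV v, ← homProj_zero_add_one hC c, TensorProduct.add_tmul,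
        TensorProduct.tmul_add, TensorProduct.tmul_add]
      refine Submodule.add_mem _ (Submodule.add_mem _ ?_ ?_) (Submodule.add_mem _ ?_ ?_)
      · exact Submodule.mem_sup_left
          (tmul_mem_tensorGrading (by decide) (homProj_mem hV 0 v) (homProj_mem hC 0 c))
      · exact Submodule.mem_sup_right
          (tmul_mem_tensorGrading (by decide) (homProj_mem hV 0 v) (homProj_mem hC 1 c))
      · exact Submodule.mem_sup_right
          (tmul_mem_tensorGrading (by decide) (homProj_mem hV 1 v) (homProj_mem hC 0 c))
      · exact Submodule.mem_sup_left
          (tmul_mem_tensorGrading (by decide) (homProj_mem hV 1 v) (homProj_mem hC 1 c))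

end Grading

/-! ### Comodules as modules over the dual of the coalgebra -/

theorem slice_assoc_symm {k : Type*} [Field k] {C V : Type*} [AddCommGroup C] [Module k C]
    [AddCommGroup V] [Module k V] (f : Module.Dual k C)
    (z : V ⊗[k] (C ⊗[k] C)) :
    slice f ((TensorProduct.assoc k V C C).symm z) = (slice f).lTensor V z := by
  have : slice f ∘ₗ (TensorProduct.assoc k V C C).symm.toLinearMap = (slice f).lTensor V :=
    TensorProduct.ext_threefold' fun x y z => by simp
  exact LinearMap.congr_fun this z

namespace Comodule

variable {k : Type u} [Field k] {C : Type v} [AddCommGroup C] [Module k C] [Coalgebra k C]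

/-- The action of a linear functional on a comodule. -/
noncomputable def act (V : Comodule.{u, v, w} k C) (f : Module.Dual k C) :
    V.carrier →ₗ[k] V.carrier :=
  slice f ∘ₗ V.coact

/-- The action of a linear functional on the coalgebra itself. -/
noncomputable def actSelf (f : Module.Dual k C) : C →ₗ[k] C :=
  slice f ∘ₗ CoalgebraStruct.comul (R := k) (A := C)

theorem act_add (V : Comodule.{u, v, w} k C) (f g : Module.Dual k C) (x : V.carrier) :
    V.act (f + g) x = V.act f x + V.act g x :=
  slice_add f g _

theorem isHom_iff {V : Comodule.{u, v, w} k C} {W : Comodule.{u, v, w'} k C}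
    {φ : V.carrier →ₗ[k] W.carrier} :
    V.IsHom W φ ↔ ∀ f x, φ (V.act f x) = W.act f (φ x) := by
  constructor
  · intro h f x
    have := congrArg (slice f) (LinearMap.congr_fun h x)
    rw [LinearMap.comp_apply, LinearMap.comp_apply, slice_rTensor] at this
    exact this.symm
  · intro h
    refine LinearMap.ext fun x => slice_ext fun f => ?_
    rw [LinearMap.comp_apply, LinearMap.comp_apply, slice_rTensor]
    exact (h f x).symm

theorem isSub_iff {V : Comodule.{u, v, w} k C} {N : Submodule k V.carrier} :
    V.IsSub N ↔ ∀ f, ∀ x ∈ N, V.act f x ∈ N :=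
  ⟨fun h f x hx => mem_map₂_top_iff.1 (h x hx) f,
    fun h x hx => mem_map₂_top_iff.2 fun f => h f x hx⟩

theorem act_counit (V : Comodule.{u, v, w} k C) (x : V.carrier) :
    V.act (CoalgebraStruct.counit (R := k) (A := C)) x = x := by
  have := congrArg (TensorProduct.rid k V.carrier) (LinearMap.congr_fun V.counit_coact x)
  rw [act, slice]
  simpa using this

theorem slice_assoc_symm_comul {V : Type*} [AddCommGroup V] [Module k V] (f : Module.Dual k C)
    (z : V ⊗[k] C) :
    slice f ((TensorProduct.assoc k V C C).symm
      ((CoalgebraStruct.comul (R := k) (A := C)).lTensor V z)) = (actSelf f).lTensor V z := by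
  rw [slice_assoc_symm, actSelf, LinearMap.lTensor_comp]
  rfl

theorem coact_act (V : Comodule.{u, v, w} k C) (f : Module.Dual k C) (x : V.carrier) :
    V.coact (V.act f x) = (actSelf f).lTensor V.carrier (V.coact x) := by
  have h : V.coact.rTensor C (V.coact x) = (TensorProduct.assoc k V.carrier C C).symm
      ((CoalgebraStruct.comul (R := k) (A := C)).lTensor V.carrier (V.coact x)) := by
    rw [LinearEquiv.eq_symm_apply]
    exact LinearMap.congr_fun V.coassoc x
  rw [← slice_assoc_symm_comul, ← h, slice_rTensor]
  rfl

/-- Coassociativity after contraction: `g ∘ₗ actSelf f` is the convolution product of `g` and `f`,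
so functionals act as an algebra. -/
theorem act_act (V : Comodule.{u, v, w} k C) (g f : Module.Dual k C) (x : V.carrier) :
    V.act g (V.act f x) = V.act (g ∘ₗ actSelf f) x := by
  rw [act, LinearMap.comp_apply, coact_act, slice_lTensor]
  rfl

theorem actSelf_actSelf (g f : Module.Dual k C) (c : C) :
    actSelf g (actSelf f c) = actSelf (g ∘ₗ actSelf f) c :=
  act_act (k := k) (C := C) ⟨C, CoalgebraStruct.comul, Coalgebra.coassoc,
    Coalgebra.lTensor_counit_comp_comul⟩ g f c

/-- A comodule given by a coaction whose contractions with linear functionals form an action. -/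
@[reducible]
def ofCoact (M : Type w) [AddCommGroup M] [Module k M] (δ : M →ₗ[k] M ⊗[k] C)
    (h1 : ∀ g f x, slice g (δ (slice f (δ x))) = slice (g ∘ₗ actSelf f) (δ x))
    (h2 : ∀ x, slice (CoalgebraStruct.counit (R := k) (A := C)) (δ x) = x) :
    Comodule.{u, v, w} k C where
  carrier := M
  coact := δ
  coassoc := by
    refine LinearMap.ext fun x => ?_
    change TensorProduct.assoc k M C C (δ.rTensor C (δ x)) = _
    rw [← LinearEquiv.eq_symm_apply]
    refine slice_ext fun f => slice_ext fun g => ?_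
    rw [slice_rTensor, h1, LinearMap.comp_apply, slice_assoc_symm_comul, slice_lTensor]
  counit_coact := by
    refine LinearMap.ext fun x => (TensorProduct.rid k M).injective ?_
    have := h2 x
    simp only [slice, LinearMap.comp_apply] at this
    simpa using this

/-- Local finiteness: `V.coact x` is a finite sum of pure tensors, and its left factors span a space
containing the whole orbit of `x`. -/
theorem finite_range_act (V : Comodule.{u, v, w} k C) (x : V.carrier) :
    ∃ N : Submodule k V.carrier, Module.Finite k N ∧ V.IsSub N ∧ x ∈ N ∧
      ∀ y ∈ N, ∃ f, V.act f x = y := by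
  let a : Module.Dual k C →ₗ[k] V.carrier :=
    { toFun f := V.act f x
      map_add' f g := slice_add f g _
      map_smul' r f := slice_smul r f _ }
  refine ⟨LinearMap.range a, ?_, ?_, ⟨_, V.act_counit x⟩, ?_⟩
  · classical
    obtain ⟨s, hs⟩ := TensorProduct.eq_repr_basis_right (Module.Basis.ofVectorSpace k C)
      (V.coact x)
    have : LinearMap.range a ≤ Submodule.span k (s.support.image s : Finset V.carrier) := by
      rintro _ ⟨f, rfl⟩
      change slice f (V.coact x) ∈ _
      rw [← hs, Finsupp.sum, map_sum]
      refine Submodule.sum_mem _ fun i hi => ?_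
      rw [slice_tmul]
      exact Submodule.smul_mem _ _ (Submodule.subset_span (Finset.mem_coe.2
        (Finset.mem_image_of_mem _ hi)))
    exact Submodule.finiteDimensional_of_le this
  · refine isSub_iff.2 ?_
    rintro f _ ⟨g, rfl⟩
    exact ⟨_, (V.act_act f g x).symm⟩
  · rintro _ ⟨f, rfl⟩
    exact ⟨f, rfl⟩

end Comodule

/-! ### Homogeneous functionals and graded comodules -/

/-- The functional `f` is homogeneous of degree `m`. -/
def IsHomogDual {k : Type*} [Field k] {C : Type*} [AddCommGroup C] [Module k C]
    (𝒞 : ZMod 2 → Submodule k C) (m : ZMod 2) (f : Module.Dual k C) : Prop :=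
  𝒞 (m + 1) ≤ LinearMap.ker f

theorem exists_isHomogDual_add {k : Type*} [Field k] {C : Type*} [AddCommGroup C] [Module k C]
    {𝒞 : ZMod 2 → Submodule k C} (h : IsCompl (𝒞 0) (𝒞 1)) (f : Module.Dual k C) :
    ∃ f₀ f₁, IsHomogDual 𝒞 0 f₀ ∧ IsHomogDual 𝒞 1 f₁ ∧ f = f₀ + f₁ := by
  refine ⟨f ∘ₗ homProj h 0, f ∘ₗ homProj h 1, fun c hc => ?_, fun c hc => ?_, ?_⟩
  · rw [LinearMap.mem_ker, LinearMap.comp_apply, homProj_of_mem_add_one h hc, map_zero]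
  · rw [LinearMap.mem_ker, LinearMap.comp_apply, homProj_of_mem_add_one h hc, map_zero]
  · ext c
    rw [LinearMap.add_apply, LinearMap.comp_apply, LinearMap.comp_apply, ← map_add,
      homProj_zero_add_one]

namespace GradedComodule

variable {k : Type u} [Field k] {C : Type v} [AddCommGroup C] [Module k C] [Coalgebra k C]
  {𝒞 : ZMod 2 → Submodule k C}

/-- The projection onto the part of degree `n`. -/
noncomputable def proj (V : GradedComodule.{u, v, w} 𝒞) (n : ZMod 2) :
    V.carrier →ₗ[k] V.carrier :=
  homProj V.isCompl n

section proj

variable (V : GradedComodule.{u, v, w} 𝒞)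

theorem proj_mem (n : ZMod 2) (x : V.carrier) : V.proj n x ∈ V.gr n := homProj_mem _ _ _

theorem proj_of_mem {n : ZMod 2} {x : V.carrier} (hx : x ∈ V.gr n) : V.proj n x = x :=
  homProj_of_mem _ hx

theorem proj_add_one_of_mem {n : ZMod 2} {x : V.carrier} (hx : x ∈ V.gr n) :
    V.proj (n + 1) x = 0 :=
  homProj_add_one_of_mem _ hx

theorem proj_of_mem_add_one {n : ZMod 2} {x : V.carrier} (hx : x ∈ V.gr (n + 1)) :
    V.proj n x = 0 :=
  homProj_of_mem_add_one _ hx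

theorem proj_add (n : ZMod 2) (x : V.carrier) : V.proj n x + V.proj (n + 1) x = x :=
  homProj_add _ n x

theorem proj_zero_add_one (x : V.carrier) : V.proj 0 x + V.proj 1 x = x :=
  homProj_zero_add_one _ x

theorem proj_one_of_mem {x : V.carrier} (hx : x ∈ V.gr 0) : V.proj 1 x = 0 := by
  simpa using V.proj_add_one_of_mem hx

theorem proj_zero_of_mem {x : V.carrier} (hx : x ∈ V.gr 1) : V.proj 0 x = 0 :=
  V.proj_of_mem_add_one (by simpa using hx)

theorem disjoint_gr {n : ZMod 2} {x : V.carrier} (h0 : x ∈ V.gr n) (h1 : x ∈ V.gr (n + 1)) :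
    x = 0 := by
  rw [← V.proj_of_mem h0, V.proj_of_mem_add_one h1]

end proj

theorem isSub_iff {V : GradedComodule.{u, v, w} 𝒞} {N : Submodule k V.carrier} :
    V.IsSub N ↔ (∀ f, ∀ x ∈ N, V.act f x ∈ N) ∧ ∀ n, ∀ x ∈ N, V.proj n x ∈ N := by
  rw [IsSub, Comodule.isSub_iff]
  refine and_congr_right fun _ => ⟨fun h n x hx => ?_, fun h x hx => ?_⟩
  · obtain ⟨y, hy, z, hz, rfl⟩ := Submodule.mem_sup.1 (h hx)
    rw [map_add]
    rcases ZMod.two_eq_or n 0 with rfl | rfl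
    · rw [V.proj_of_mem hy.2, V.proj_of_mem_add_one (n := 0) (by simpa using hz.2), add_zero]
      exact hy.1
    · rw [V.proj_add_one_of_mem hy.2, zero_add, V.proj_of_mem (by simpa using hz.2)]
      exact hz.1
  · rw [← V.proj_zero_add_one x]
    exact Submodule.add_mem_sup ⟨h 0 x hx, V.proj_mem 0 x⟩ ⟨h 1 x hx, V.proj_mem 1 x⟩

theorem isHom_iff {V : GradedComodule.{u, v, w} 𝒞} {W : GradedComodule.{u, v, w'} 𝒞}
    {φ : V.carrier →ₗ[k] W.carrier} :
    V.IsHom W φ ↔ (∀ f x, φ (V.act f x) = W.act f (φ x)) ∧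
      ∀ n x, φ (V.proj n x) = W.proj n (φ x) := by
  rw [IsHom, Comodule.isHom_iff]
  refine and_congr_right fun _ => ⟨fun h n x => ?_, fun h n x hx => ?_⟩
  · conv_rhs => rw [← V.proj_add n x, map_add, map_add]
    rw [W.proj_of_mem (h n _ (V.proj_mem n x)), W.proj_of_mem_add_one, add_zero]
    exact h _ _ (V.proj_mem _ x)
  · rw [← V.proj_of_mem hx, h]
    exact W.proj_mem _ _

section graded

variable [IsGradedCoalgebra 𝒞]

theorem act_mem (V : GradedComodule.{u, v, w} 𝒞) {m n : ZMod 2} {f : Module.Dual k C}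
    (hf : IsHomogDual 𝒞 m f) {x : V.carrier} (hx : x ∈ V.gr n) : V.act f x ∈ V.gr (n + m) :=
  (mem_tensorGrading_iff IsGradedCoalgebra.isCompl).1 (V.coact_mem n x hx) m f hf

theorem act_proj (V : GradedComodule.{u, v, w} 𝒞) {m : ZMod 2} {f : Module.Dual k C}
    (hf : IsHomogDual 𝒞 m f) (n : ZMod 2) (x : V.carrier) :
    V.act f (V.proj n x) = V.proj (n + m) (V.act f x) := by
  conv_rhs => rw [← V.proj_add n x, map_add, map_add]
  have h : V.act f (V.proj (n + 1) x) ∈ V.gr (n + m + 1) := by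
    rw [add_right_comm]
    exact V.act_mem hf (V.proj_mem _ x)
  rw [V.proj_of_mem (V.act_mem hf (V.proj_mem n x)), V.proj_of_mem_add_one h, add_zero]

end graded

end GradedComodule

/-! ### Homomorphisms and subcomodules -/

theorem rTensor_subtype_injective {k : Type*} [Field k] (C : Type*) [AddCommGroup C] [Module k C]
    {V : Type*} [AddCommGroup V] [Module k V] (N : Submodule k V) :
    Function.Injective (N.subtype.rTensor C) :=
  Module.Flat.rTensor_preserves_injective_linearMap _ N.injective_subtype

theorem mem_range_rTensor_subtype {k : Type*} [Field k] {C : Type*} [AddCommGroup C] [Module k C]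
    {V : Type*} [AddCommGroup V] [Module k V]
    {N : Submodule k V} {z : V ⊗[k] C} (h : ∀ f : Module.Dual k C, slice f z ∈ N) :
    z ∈ LinearMap.range (N.subtype.rTensor C) := by
  refine (Submodule.map₂_le.2 ?_ : _ ≤ _) (mem_map₂_top_iff.2 h)
  exact fun v hv c _ => ⟨⟨v, hv⟩ ⊗ₜ c, by simp⟩

namespace Comodule

variable {k : Type u} [Field k] {C : Type v} [AddCommGroup C] [Module k C] [Coalgebra k C]
  {V : Comodule.{u, v, w} k C} {W : Comodule.{u, v, w'} k C} {X : Comodule.{u, v, w''} k C}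

theorem IsHom.comp {g : W.carrier →ₗ[k] X.carrier} {f : V.carrier →ₗ[k] W.carrier}
    (hg : W.IsHom X g) (hf : V.IsHom W f) : V.IsHom X (g ∘ₗ f) := by
  rw [isHom_iff] at *
  intro a x
  simp [hf, hg]

theorem IsHom.symm {e : V.carrier ≃ₗ[k] W.carrier} (he : V.IsHom W e.toLinearMap) :
    W.IsHom V e.symm.toLinearMap := by
  rw [isHom_iff] at *
  intro a x
  obtain ⟨y, rfl⟩ := e.surjective x
  apply e.injective
  simpa using (he a y).symm

theorem Iso.symm (h : V.Iso W) : W.Iso V :=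
  let ⟨e, he⟩ := h
  ⟨e.symm, he.symm⟩

theorem Iso.trans (h : V.Iso W) (h' : W.Iso X) : V.Iso X :=
  let ⟨e, he⟩ := h
  let ⟨e', he'⟩ := h'
  ⟨e.trans e', he'.comp he⟩

theorem IsSub.map {φ : V.carrier →ₗ[k] W.carrier} (hφ : V.IsHom W φ)
    {N : Submodule k V.carrier} (hN : V.IsSub N) : W.IsSub (N.map φ) := by
  rw [isSub_iff] at *
  rw [isHom_iff] at hφ
  rintro f _ ⟨x, hx, rfl⟩
  exact ⟨_, hN f x hx, hφ f x⟩

theorem IsSub.comap {φ : V.carrier →ₗ[k] W.carrier} (hφ : V.IsHom W φ)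
    {N : Submodule k W.carrier} (hN : W.IsSub N) : V.IsSub (N.comap φ) := by
  rw [isSub_iff] at *
  rw [isHom_iff] at hφ
  intro f x hx
  rw [Submodule.mem_comap, hφ]
  exact hN f _ hx

theorem IsSub.inf {N N' : Submodule k V.carrier} (hN : V.IsSub N) (hN' : V.IsSub N') :
    V.IsSub (N ⊓ N') := by
  rw [isSub_iff] at *
  exact fun f x hx => ⟨hN f x hx.1, hN' f x hx.2⟩

theorem isSub_bot : V.IsSub ⊥ := by
  rw [isSub_iff]
  intro f x hx
  simp_all

theorem isSub_top : V.IsSub ⊤ := isSub_iff.2 fun _ _ _ => trivial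

end Comodule

namespace GradedComodule

variable {k : Type u} [Field k] {C : Type v} [AddCommGroup C] [Module k C] [Coalgebra k C]
  {𝒞 : ZMod 2 → Submodule k C} {V : GradedComodule.{u, v, w} 𝒞}
  {W : GradedComodule.{u, v, w'} 𝒞} {X : GradedComodule.{u, v, w''} 𝒞}

theorem isHom_id : V.IsHom V LinearMap.id := isHom_iff.2 ⟨fun _ _ => rfl, fun _ _ => rfl⟩

theorem IsHom.comp {g : W.carrier →ₗ[k] X.carrier} {f : V.carrier →ₗ[k] W.carrier}
    (hg : W.IsHom X g) (hf : V.IsHom W f) : V.IsHom X (g ∘ₗ f) :=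
  ⟨hg.1.comp hf.1, fun n x hx => hg.2 n _ (hf.2 n x hx)⟩

theorem IsHom.sub {g f : V.carrier →ₗ[k] W.carrier} (hg : V.IsHom W g) (hf : V.IsHom W f) :
    V.IsHom W (g - f) := by
  rw [isHom_iff] at *
  exact ⟨fun a x => by simp [hg.1, hf.1], fun n x => by simp [hg.2, hf.2]⟩

theorem IsHom.add {g f : V.carrier →ₗ[k] W.carrier} (hg : V.IsHom W g) (hf : V.IsHom W f) :
    V.IsHom W (g + f) := by
  rw [isHom_iff] at *
  exact ⟨fun a x => by simp [hg.1, hf.1], fun n x => by simp [hg.2, hf.2]⟩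

theorem IsHom.smul {f : V.carrier →ₗ[k] W.carrier} (c : k) (hf : V.IsHom W f) :
    V.IsHom W (c • f) := by
  rw [isHom_iff] at *
  exact ⟨fun a x => by simp [hf.1], fun n x => by simp [hf.2]⟩

theorem IsHom.symm {e : V.carrier ≃ₗ[k] W.carrier} (he : V.IsHom W e.toLinearMap) :
    W.IsHom V e.symm.toLinearMap := by
  rw [isHom_iff] at *
  refine ⟨fun a x => ?_, fun n x => ?_⟩ <;>
  · obtain ⟨y, rfl⟩ := e.surjective x
    apply e.injective
    first
      | simpa using (he.1 a y).symm
      | simpa using (he.2 n y).symm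

theorem Iso.symm (h : V.Iso W) : W.Iso V :=
  let ⟨e, he⟩ := h
  ⟨e.symm, he.symm⟩

theorem Iso.trans (h : V.Iso W) (h' : W.Iso X) : V.Iso X :=
  let ⟨e, he⟩ := h
  let ⟨e', he'⟩ := h'
  ⟨e.trans e', he'.comp he⟩

theorem Iso.toComodule (h : V.Iso W) : V.toComodule.Iso W.toComodule :=
  let ⟨e, he⟩ := h
  ⟨e, he.1⟩

theorem IsHom.iso {φ : V.carrier →ₗ[k] W.carrier} (hφ : V.IsHom W φ)
    (h : Function.Bijective φ) : V.Iso W :=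
  ⟨LinearEquiv.ofBijective φ h, hφ⟩

theorem isSub_bot : V.IsSub ⊥ := by
  rw [isSub_iff]
  constructor <;> intro _ x hx <;> simp_all

theorem isSub_top : V.IsSub ⊤ := isSub_iff.2 ⟨fun _ _ _ => trivial, fun _ _ _ => trivial⟩

theorem IsSub.inf {N N' : Submodule k V.carrier} (hN : V.IsSub N) (hN' : V.IsSub N') :
    V.IsSub (N ⊓ N') := by
  rw [isSub_iff] at *
  exact ⟨fun f x hx => ⟨hN.1 f x hx.1, hN'.1 f x hx.2⟩,
    fun f x hx => ⟨hN.2 f x hx.1, hN'.2 f x hx.2⟩⟩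

theorem isSub_sSup {s : Set (Submodule k V.carrier)} (h : ∀ N ∈ s, V.IsSub N) :
    V.IsSub (sSup s) := by
  rw [isSub_iff]
  refine ⟨fun f => ?_, fun n => ?_⟩
  · change sSup s ≤ (sSup s).comap (V.act f)
    exact sSup_le fun N hN x hx => (le_sSup hN : N ≤ sSup s) ((isSub_iff.1 (h N hN)).1 f x hx)
  · change sSup s ≤ (sSup s).comap (V.proj n)
    exact sSup_le fun N hN x hx => (le_sSup hN : N ≤ sSup s) ((isSub_iff.1 (h N hN)).2 n x hx)

theorem IsSub.sup {N N' : Submodule k V.carrier} (hN : V.IsSub N) (hN' : V.IsSub N') :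
    V.IsSub (N ⊔ N') := by
  rw [← sSup_pair]
  refine isSub_sSup ?_
  simp [hN, hN']

theorem IsSub.map {φ : V.carrier →ₗ[k] W.carrier} (hφ : V.IsHom W φ)
    {N : Submodule k V.carrier} (hN : V.IsSub N) : W.IsSub (N.map φ) := by
  rw [isSub_iff] at *
  rw [isHom_iff] at hφ
  constructor
  · rintro f _ ⟨x, hx, rfl⟩
    exact ⟨_, hN.1 f x hx, hφ.1 f x⟩
  · rintro n _ ⟨x, hx, rfl⟩
    exact ⟨_, hN.2 n x hx, hφ.2 n x⟩

theorem IsSub.comap {φ : V.carrier →ₗ[k] W.carrier} (hφ : V.IsHom W φ)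
    {N : Submodule k W.carrier} (hN : W.IsSub N) : V.IsSub (N.comap φ) := by
  rw [isSub_iff] at *
  rw [isHom_iff] at hφ
  constructor
  · intro f x hx
    rw [Submodule.mem_comap, hφ.1]
    exact hN.1 f _ hx
  · intro n x hx
    rw [Submodule.mem_comap, hφ.2]
    exact hN.2 n _ hx

theorem IsHom.isSub_range {φ : V.carrier →ₗ[k] W.carrier} (hφ : V.IsHom W φ) :
    W.IsSub (LinearMap.range φ) := by
  rw [← Submodule.map_top]
  exact isSub_top.map hφ

theorem IsHom.isSub_ker {φ : V.carrier →ₗ[k] W.carrier} (hφ : V.IsHom W φ) :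
    V.IsSub (LinearMap.ker φ) :=
  isSub_bot.comap hφ

/-! ### Reversal of the grading -/

section reverse

theorem gr_reverse (V : GradedComodule.{u, v, w} 𝒞) (n : ZMod 2) :
    V.reverse.gr n = V.gr (n + 1) := rfl

theorem gr_reverse_reverse (V : GradedComodule.{u, v, w} 𝒞) (n : ZMod 2) :
    V.reverse.reverse.gr n = V.gr n := by
  rw [gr_reverse, gr_reverse, add_assoc, ZMod.two_add_self, add_zero]

theorem isSub_reverse_iff {N : Submodule k V.carrier} : V.reverse.IsSub N ↔ V.IsSub N := by
  refine (isSub_iff (V := V.reverse) (N := N)).trans (Iff.trans ?_ isSub_iff.symm)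
  refine and_congr Iff.rfl ⟨fun h n x hx => ?_, fun h n x hx => h (n + 1) x hx⟩
  have : V.proj (n + 1 + 1) x ∈ N := h (n + 1) x hx
  rwa [add_assoc, ZMod.two_add_self, add_zero] at this

theorem isSimpleSub_reverse_iff {N : Submodule k V.carrier} :
    V.reverse.IsSimpleSub N ↔ V.IsSimpleSub N :=
  and_congr isSub_reverse_iff (and_congr Iff.rfl
    (forall_congr' fun _ => imp_congr isSub_reverse_iff Iff.rfl))

theorem socle_reverse : V.reverse.socle = V.socle :=
  congrArg sSup (Set.ext fun _ => isSimpleSub_reverse_iff)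

theorem IsHom.reverse {φ : V.carrier →ₗ[k] W.carrier} (h : V.IsHom W φ) :
    V.reverse.IsHom W.reverse φ :=
  ⟨h.1, fun n => h.2 (n + 1)⟩

theorem isHom_reverse_reverse (V : GradedComodule.{u, v, w} 𝒞) :
    V.IsHom V.reverse.reverse LinearMap.id :=
  ⟨isHom_id.1, fun n x hx => by rwa [gr_reverse_reverse]⟩

theorem reverse_reverse_isHom (V : GradedComodule.{u, v, w} 𝒞) :
    V.reverse.reverse.IsHom V LinearMap.id :=
  ⟨isHom_id.1, fun n x hx => by rwa [gr_reverse_reverse] at hx⟩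

theorem Iso.reverse_right (h : V.reverse.Iso W) : V.Iso W.reverse :=
  let ⟨e, he⟩ := h
  ⟨e, he.reverse.comp V.isHom_reverse_reverse⟩

end reverse

/-! ### Subcomodules as comodules in their own right -/

section ofSub

/-- The coaction of a subcomodule. -/
noncomputable def subCoact (V : GradedComodule.{u, v, w} 𝒞) (N : Submodule k V.carrier)
    (hN : V.IsSub N) : N →ₗ[k] N ⊗[k] C :=
  (LinearEquiv.ofInjective _ (rTensor_subtype_injective C N)).symm.toLinearMap ∘ₗ
    (V.coact ∘ₗ N.subtype).codRestrict (LinearMap.range (N.subtype.rTensor C))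
      fun x => mem_range_rTensor_subtype fun f => (isSub_iff.1 hN).1 f x x.2

theorem rTensor_subCoact (V : GradedComodule.{u, v, w} 𝒞) (N : Submodule k V.carrier)
    (hN : V.IsSub N) (x : N) : N.subtype.rTensor C (V.subCoact N hN x) = V.coact x :=
  congrArg Subtype.val (LinearEquiv.apply_symm_apply
    (LinearEquiv.ofInjective _ (rTensor_subtype_injective C N)) _)

theorem slice_subCoact (V : GradedComodule.{u, v, w} 𝒞) (N : Submodule k V.carrier)
    (hN : V.IsSub N) (x : N) (f : Module.Dual k C) :
    ((slice f (V.subCoact N hN x) : N) : V.carrier) = V.act f x := by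
  rw [Comodule.act, LinearMap.comp_apply, ← rTensor_subCoact V N hN, slice_rTensor]
  rfl

variable [IsGradedCoalgebra 𝒞]

/-- A graded subcomodule as a graded comodule. -/
@[reducible]
noncomputable def ofSub (V : GradedComodule.{u, v, w} 𝒞) (N : Submodule k V.carrier)
    (hN : V.IsSub N) : GradedComodule.{u, v, w} 𝒞 where
  toComodule := Comodule.ofCoact N (V.subCoact N hN)
    (fun g f x => Subtype.ext (by
      rw [slice_subCoact, slice_subCoact, slice_subCoact, Comodule.act_act]))
    (fun x => Subtype.ext (by rw [slice_subCoact, Comodule.act_counit]))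
  gr n := (V.gr n).comap N.subtype
  isCompl := by
    constructor
    · rw [Submodule.disjoint_def]
      intro x h0 h1
      exact Subtype.ext (V.disjoint_gr (n := 0) h0 (by simpa using h1))
    · rw [codisjoint_iff, eq_top_iff]
      intro x _
      refine Submodule.mem_sup.2 ⟨⟨V.proj 0 x, (isSub_iff.1 hN).2 0 x x.2⟩, V.proj_mem 0 _,
        ⟨V.proj 1 x, (isSub_iff.1 hN).2 1 x x.2⟩, V.proj_mem 1 _, ?_⟩
      exact Subtype.ext (V.proj_zero_add_one _)
  coact_mem n x hx := by
    refine (mem_tensorGrading_iff IsGradedCoalgebra.isCompl).2 fun m f hf => ?_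
    rw [Submodule.mem_comap, Submodule.subtype_apply, slice_subCoact]
    exact V.act_mem hf hx

theorem ofSub_act {N : Submodule k V.carrier} (hN : V.IsSub N) (f : Module.Dual k C) (x : N) :
    (((V.ofSub N hN).act f x : N) : V.carrier) = V.act f (x : V.carrier) :=
  slice_subCoact V N hN x f

/-- The inclusion of a graded subcomodule. -/
def incl (V : GradedComodule.{u, v, w} 𝒞) (N : Submodule k V.carrier) (hN : V.IsSub N) :
    (V.ofSub N hN).carrier →ₗ[k] V.carrier :=
  N.subtype

theorem incl_injective {N : Submodule k V.carrier} (hN : V.IsSub N) :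
    Function.Injective (V.incl N hN) :=
  N.injective_subtype

theorem range_incl {N : Submodule k V.carrier} (hN : V.IsSub N) :
    LinearMap.range (V.incl N hN) = N :=
  N.range_subtype

theorem isHom_incl {N : Submodule k V.carrier} (hN : V.IsSub N) :
    (V.ofSub N hN).IsHom V (V.incl N hN) :=
  ⟨Comodule.isHom_iff.2 fun f x => ofSub_act hN f x, fun _ _ hx => hx⟩

/-- The corestriction of a linear map to a subcomodule containing its range. -/
def corestrict (N : Submodule k V.carrier) (hN : V.IsSub N)
    {M : Type*} [AddCommGroup M] [Module k M] (φ : M →ₗ[k] V.carrier) (h : ∀ x, φ x ∈ N) :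
    M →ₗ[k] (V.ofSub N hN).carrier :=
  φ.codRestrict N h

theorem incl_corestrict {N : Submodule k V.carrier} (hN : V.IsSub N)
    {M : Type*} [AddCommGroup M] [Module k M] (φ : M →ₗ[k] V.carrier) (h : ∀ x, φ x ∈ N) (x : M) :
    V.incl N hN (corestrict N hN φ h x) = φ x := rfl

theorem isHom_corestrict_toComodule {U : Comodule.{u, v, w'} k C} {N : Submodule k V.carrier}
    (hN : V.IsSub N) {φ : U.carrier →ₗ[k] V.carrier} (hφ : U.IsHom V.toComodule φ)
    (h : ∀ x, φ x ∈ N) :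
    U.IsHom (V.ofSub N hN).toComodule (corestrict N hN φ h) :=
  Comodule.isHom_iff.2 fun f x => incl_injective hN (by
    rw [Comodule.isHom_iff.1 (isHom_incl hN).1, incl_corestrict, incl_corestrict,
      Comodule.isHom_iff.1 hφ])

theorem isHom_corestrict {N : Submodule k V.carrier} (hN : V.IsSub N)
    {φ : W.carrier →ₗ[k] V.carrier} (hφ : W.IsHom V φ) (h : ∀ x, φ x ∈ N) :
    W.IsHom (V.ofSub N hN) (corestrict N hN φ h) :=
  ⟨isHom_corestrict_toComodule hN hφ.1 h, fun n x hx => hφ.2 n x hx⟩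

end ofSub

/-! ### Cofree comodules and extension of homomorphisms -/

section cofree

theorem coact_injective : Function.Injective V.coact := fun x y h => by
  rw [← V.act_counit x, ← V.act_counit y, Comodule.act, LinearMap.comp_apply, h,
    LinearMap.comp_apply]

variable [IsGradedCoalgebra 𝒞]

theorem actSelf_mem {m n : ZMod 2} {f : Module.Dual k C} (hf : IsHomogDual 𝒞 m f) {c : C}
    (hc : c ∈ 𝒞 n) : Comodule.actSelf f c ∈ 𝒞 (n + m) :=
  (regular 𝒞).act_mem hf hc

/-- The cofree comodule `V ⊗ C`. -/
@[reducible]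
noncomputable def cofree (V : GradedComodule.{u, v, w} 𝒞) :
    GradedComodule.{u, v, max v w} 𝒞 where
  toComodule := Comodule.ofCoact (V.carrier ⊗[k] C)
    ((TensorProduct.assoc k V.carrier C C).symm.toLinearMap ∘ₗ
      (CoalgebraStruct.comul (R := k) (A := C)).lTensor V.carrier)
    (fun g f z => by
      simp only [LinearMap.comp_apply, LinearEquiv.coe_coe, Comodule.slice_assoc_symm_comul]
      rw [← LinearMap.comp_apply, ← LinearMap.lTensor_comp]
      congr 2
      exact LinearMap.ext fun c => Comodule.actSelf_actSelf g f c)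
    (fun z => by
      simp only [LinearMap.comp_apply, LinearEquiv.coe_coe, Comodule.slice_assoc_symm_comul]
      have : Comodule.actSelf (CoalgebraStruct.counit (R := k) (A := C)) = LinearMap.id :=
        LinearMap.ext (regular 𝒞).act_counit
      rw [this, LinearMap.lTensor_id, LinearMap.id_apply])
  gr := tensorGrading V.gr 𝒞
  isCompl := isCompl_tensorGrading V.isCompl IsGradedCoalgebra.isCompl
  coact_mem n z hz := by
    refine (mem_tensorGrading_iff IsGradedCoalgebra.isCompl).2 fun m f hf => ?_
    simp only [LinearMap.comp_apply, LinearEquiv.coe_coe, Comodule.slice_assoc_symm_comul]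
    refine (iSup_le fun a => Submodule.map₂_le.2 ?_ : tensorGrading V.gr 𝒞 n ≤
      (tensorGrading V.gr 𝒞 (n + m)).comap ((Comodule.actSelf f).lTensor V.carrier)) hz
    intro v hv c hc
    exact tmul_mem_tensorGrading (a := a) (b := n - a + m) (by ring) hv (actSelf_mem hf hc)

theorem cofree_act (f : Module.Dual k C) (z : V.carrier ⊗[k] C) :
    (V.cofree.act f z : V.carrier ⊗[k] C) = (Comodule.actSelf f).lTensor V.carrier z :=
  Comodule.slice_assoc_symm_comul f z

theorem isHom_coact : V.IsHom V.cofree V.coact :=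
  ⟨Comodule.isHom_iff.2 fun f x => (V.coact_act f x).trans (cofree_act f _).symm,
    V.coact_mem⟩

/-- The coaction `V → V ⊗ C` is a split monomorphism. -/
def CoactSplits (V : GradedComodule.{u, v, w} 𝒞) : Prop :=
  ∃ r : V.cofree.carrier →ₗ[k] V.carrier, V.cofree.IsHom V r ∧ ∀ x, r (V.coact x) = x

/-- `IsInjective` only tests containing comodules in the universe of `V`. For carriers in the
universe of `C` the cofree comodule is among them, and this one test already yields the
universe-free splitting. -/
theorem IsInjective.coactSplits {V : GradedComodule.{u, v, v} 𝒞} (h : V.IsInjective) :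
    V.CoactSplits :=
  let ⟨r, hr, e⟩ := h V.cofree V.coact isHom_coact coact_injective
  ⟨r, hr, LinearMap.congr_fun e⟩

/-- A merely linear extension `F` of `f` to `W` suffices, since `F ⊗ C` is automatically a map of
cofree comodules. Composing it with the coaction of `W` and the retraction onto `V` gives a comodule
map. -/
theorem CoactSplits.exists_extension (h : V.CoactSplits) {U : GradedComodule.{u, v, w'} 𝒞}
    {W : GradedComodule.{u, v, w''} 𝒞} {i : U.carrier →ₗ[k] W.carrier} (hi : U.IsHom W i)
    (hinj : Function.Injective i) {f : U.carrier →ₗ[k] V.carrier} (hf : U.IsHom V f) :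
    ∃ g : W.carrier →ₗ[k] V.carrier, W.IsHom V g ∧ ∀ x, g (i x) = f x := by
  obtain ⟨r, hr, hr'⟩ := h
  obtain ⟨l, hl⟩ := i.exists_leftInverse_of_injective (LinearMap.ker_eq_bot.2 hinj)
  -- The linear left inverse `l` need not respect degrees; keeping the diagonal blocks of `f ∘ l`
  -- does, and does not change the restriction to `U` because `i` and `f` have degree zero.
  let F : W.carrier →ₗ[k] V.carrier :=
    V.proj 0 ∘ₗ f ∘ₗ l ∘ₗ W.proj 0 + V.proj 1 ∘ₗ f ∘ₗ l ∘ₗ W.proj 1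
  have hFx x : F x = V.proj 0 (f (l (W.proj 0 x))) + V.proj 1 (f (l (W.proj 1 x))) := rfl
  have hF : ∀ n, ∀ x ∈ W.gr n, F x ∈ V.gr n := by
    intro n x hx
    rcases ZMod.two_eq_or n 0 with rfl | rfl
    · have : W.proj 1 x = 0 := W.proj_one_of_mem hx
      rw [hFx, this, map_zero, map_zero, map_zero, add_zero]
      exact V.proj_mem _ _
    · have : W.proj 0 x = 0 := W.proj_zero_of_mem (by simpa using hx)
      rw [hFx, this, map_zero, map_zero, map_zero, zero_add, zero_add]
      exact V.proj_mem _ _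
  have hFi : F ∘ₗ i = f := by
    refine LinearMap.ext fun x => ?_
    have hl' y : l (i y) = y := LinearMap.congr_fun hl y
    rw [LinearMap.comp_apply, hFx, ← (isHom_iff.1 hi).2,
      ← (isHom_iff.1 hi).2, hl', hl', ← (isHom_iff.1 hf).2,
      ← (isHom_iff.1 hf).2,
      U.proj_of_mem (U.proj_mem 0 x), U.proj_of_mem (U.proj_mem 1 x), ← map_add,
      U.proj_zero_add_one]
  have hFC : W.cofree.IsHom V.cofree (F.rTensor C) := by
    constructor
    · refine Comodule.isHom_iff.2 fun a z => ?_
      rw [cofree_act, cofree_act, ← LinearMap.comp_apply, ← LinearMap.comp_apply,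
        LinearMap.rTensor_comp_lTensor, LinearMap.lTensor_comp_rTensor]
    · intro n
      refine (iSup_le fun a => Submodule.map₂_le.2 ?_ : tensorGrading W.gr 𝒞 n ≤
        (tensorGrading V.gr 𝒞 n).comap (F.rTensor C))
      intro v hv c hc
      exact tmul_mem_tensorGrading (a := a) (b := n - a) (by ring) (hF a v hv) hc
  refine ⟨r ∘ₗ F.rTensor C ∘ₗ W.coact, hr.comp (hFC.comp isHom_coact), fun x => ?_⟩
  have : W.coact (i x) = i.rTensor C (U.coact x) := LinearMap.congr_fun hi.1 x
  rw [LinearMap.comp_apply, LinearMap.comp_apply, this, ← LinearMap.comp_apply (F.rTensor C),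
    ← LinearMap.rTensor_comp, hFi, ← hr' (f x)]
  exact congrArg r (LinearMap.congr_fun hf.1 x).symm

theorem CoactSplits.isInjective (h : V.CoactSplits) : V.IsInjective := fun _ _ hf hinj =>
  let ⟨g, hg, e⟩ := h.exists_extension hf hinj isHom_id
  ⟨g, hg, LinearMap.ext e⟩

end cofree

end GradedComodule

/-! ### Simple subcomodules and essential extensions -/

theorem Submodule.exists_minimal_of_finite {k M : Type*} [Field k] [AddCommGroup M] [Module k M]
    (P : Submodule k M → Prop) (N : Submodule k M) [Module.Finite k N] (hN : P N) (h0 : N ≠ ⊥) :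
    ∃ S ≤ N, P S ∧ S ≠ ⊥ ∧ ∀ X, P X → X ≤ S → X = ⊥ ∨ X = S := by
  induction h : Module.finrank k N using Nat.strong_induction_on generalizing N with
  | _ d ih =>
    by_cases hmin : ∀ X, P X → X ≤ N → X = ⊥ ∨ X = N
    · exact ⟨N, le_rfl, hN, h0, hmin⟩
    · push Not at hmin
      obtain ⟨X, hX, hXN, hX0, hne⟩ := hmin
      have : Module.Finite k X := Submodule.finiteDimensional_of_le hXN
      obtain ⟨S, hS, hS'⟩ := ih _ (h ▸ Submodule.finrank_lt_finrank_of_lt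
        (lt_of_le_of_ne hXN hne)) X hX hX0 rfl
      exact ⟨S, hS.trans hXN, hS'⟩

namespace Comodule

variable {k : Type u} [Field k] {C : Type v} [AddCommGroup C] [Module k C] [Coalgebra k C]
  {V : Comodule.{u, v, w} k C} {W : Comodule.{u, v, w'} k C}

theorem isSub_map_iff {φ : V.carrier →ₗ[k] W.carrier} (hφ : V.IsHom W φ)
    (hinj : Function.Injective φ) {N : Submodule k V.carrier} :
    W.IsSub (N.map φ) ↔ V.IsSub N :=
  ⟨fun h => by simpa [Submodule.comap_map_eq_of_injective hinj] using h.comap hφ,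
    fun h => h.map hφ⟩

theorem isSimpleSub_map_iff {φ : V.carrier →ₗ[k] W.carrier} (hφ : V.IsHom W φ)
    (hinj : Function.Injective φ) {N : Submodule k V.carrier} :
    W.IsSimpleSub (N.map φ) ↔ V.IsSimpleSub N := by
  refine and_congr (isSub_map_iff hφ hinj) (and_congr ?_ ⟨fun h X hX hXN => ?_,
    fun h X hX hXN => ?_⟩)
  · exact ((Submodule.map_injective_of_injective hinj).eq_iff' (Submodule.map_bot φ)).not
  · rcases h _ (hX.map hφ) (Submodule.map_mono hXN) with h | h
    · exact Or.inl (Submodule.map_injective_of_injective hinj (h.trans (Submodule.map_bot φ).symm))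
    · exact Or.inr (Submodule.map_injective_of_injective hinj h)
  · have e : (X.comap φ).map φ = X := by
      rw [Submodule.map_comap_eq, inf_eq_right]
      exact hXN.trans LinearMap.map_le_range
    rw [← e]
    rcases h _ (hX.comap hφ) (by
      rw [← Submodule.comap_map_eq_of_injective hinj N]
      exact Submodule.comap_mono hXN) with h | h
    · exact Or.inl (by rw [h, Submodule.map_bot])
    · exact Or.inr (by rw [h])

end Comodule

namespace GradedComodule

variable {k : Type u} [Field k] {C : Type v} [AddCommGroup C] [Module k C] [Coalgebra k C]
  {𝒞 : ZMod 2 → Submodule k C} {V : GradedComodule.{u, v, w} 𝒞}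
  {W : GradedComodule.{u, v, w'} 𝒞}

section simple

theorem isSub_map_iff {φ : V.carrier →ₗ[k] W.carrier} (hφ : V.IsHom W φ)
    (hinj : Function.Injective φ) {N : Submodule k V.carrier} :
    W.IsSub (N.map φ) ↔ V.IsSub N :=
  ⟨fun h => by simpa [Submodule.comap_map_eq_of_injective hinj] using h.comap hφ,
    fun h => h.map hφ⟩

theorem isSimpleSub_map_iff {φ : V.carrier →ₗ[k] W.carrier} (hφ : V.IsHom W φ)
    (hinj : Function.Injective φ) {N : Submodule k V.carrier} :
    W.IsSimpleSub (N.map φ) ↔ V.IsSimpleSub N := by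
  refine and_congr (isSub_map_iff hφ hinj) (and_congr ?_ ⟨fun h X hX hXN => ?_,
    fun h X hX hXN => ?_⟩)
  · exact ((Submodule.map_injective_of_injective hinj).eq_iff' (Submodule.map_bot φ)).not
  · rcases h _ (hX.map hφ) (Submodule.map_mono hXN) with h | h
    · exact Or.inl (Submodule.map_injective_of_injective hinj (h.trans (Submodule.map_bot φ).symm))
    · exact Or.inr (Submodule.map_injective_of_injective hinj h)
  · have e : (X.comap φ).map φ = X := by
      rw [Submodule.map_comap_eq, inf_eq_right]
      exact hXN.trans LinearMap.map_le_range
    rw [← e]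
    rcases h _ (hX.comap hφ) (by
      rw [← Submodule.comap_map_eq_of_injective hinj N]
      exact Submodule.comap_mono hXN) with h | h
    · exact Or.inl (by rw [h, Submodule.map_bot])
    · exact Or.inr (by rw [h])

theorem IsSimpleSub.eq_of_ne_bot {S X : Submodule k V.carrier} (hS : V.IsSimpleSub S)
    (hX : V.IsSub X) (hle : X ≤ S) (h0 : X ≠ ⊥) : X = S :=
  (hS.2.2 X hX hle).resolve_left h0

theorem IsSimpleSub.le_of_inf_ne_bot {S X : Submodule k V.carrier} (hS : V.IsSimpleSub S)
    (hX : V.IsSub X) (h0 : S ⊓ X ≠ ⊥) : S ≤ X :=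
  inf_eq_left.1 (hS.eq_of_ne_bot (hS.1.inf hX) inf_le_left h0)

theorem IsSimpleSub.le_socle {S : Submodule k V.carrier} (hS : V.IsSimpleSub S) :
    S ≤ V.socle :=
  le_sSup hS

theorem IsSimple.ne_bot (hV : V.IsSimple) : (⊤ : Submodule k V.carrier) ≠ ⊥ := hV.2.1

theorem IsSimple.ker_eq_bot (hV : V.IsSimple) {φ : V.carrier →ₗ[k] W.carrier}
    (hφ : V.IsHom W φ) (h0 : φ ≠ 0) : LinearMap.ker φ = ⊥ :=
  (hV.2.2 _ hφ.isSub_ker le_top).resolve_right fun h => h0 (LinearMap.ker_eq_top.1 h)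

theorem IsSimple.injective (hV : V.IsSimple) {φ : V.carrier →ₗ[k] W.carrier}
    (hφ : V.IsHom W φ) (h0 : φ ≠ 0) : Function.Injective φ :=
  LinearMap.ker_eq_bot.1 (hV.ker_eq_bot hφ h0)

theorem IsSimple.isSimpleSub_range (hV : V.IsSimple) {φ : V.carrier →ₗ[k] W.carrier}
    (hφ : V.IsHom W φ) (h0 : φ ≠ 0) : W.IsSimpleSub (LinearMap.range φ) := by
  rw [← Submodule.map_top]
  exact (isSimpleSub_map_iff hφ (hV.injective hφ h0)).2 hV

theorem IsSimple.bijective (hV : V.IsSimple) (hW : W.IsSimple)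
    {φ : V.carrier →ₗ[k] W.carrier} (hφ : V.IsHom W φ) (h0 : φ ≠ 0) : Function.Bijective φ := by
  refine ⟨hV.injective hφ h0, LinearMap.range_eq_top.1 ?_⟩
  exact hW.eq_of_ne_bot hφ.isSub_range le_top (by rwa [ne_eq, LinearMap.range_eq_bot])

theorem IsSimple.reverse (hV : V.IsSimple) : V.reverse.IsSimple := isSimpleSub_reverse_iff.2 hV

theorem socle_eq_of_forall {S : Submodule k V.carrier} (hS : V.IsSimpleSub S)
    (h : ∀ X, V.IsSimpleSub X → X ≤ S) : V.socle = S :=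
  le_antisymm (sSup_le h) hS.le_socle

/-- Every nonzero graded subcomodule of `E` meets `S`. -/
def IsEssential (V : GradedComodule.{u, v, w} 𝒞) (S E : Submodule k V.carrier) : Prop :=
  ∀ X, V.IsSub X → X ≤ E → X ⊓ S = ⊥ → X = ⊥

theorem IsEssential.injective {S : Submodule k V.carrier} (h : V.IsEssential S ⊤)
    (hS : V.IsSimpleSub S) {φ : V.carrier →ₗ[k] W.carrier} (hφ : V.IsHom W φ)
    (h0 : ¬ S ≤ LinearMap.ker φ) : Function.Injective φ := by
  refine LinearMap.ker_eq_bot.1 (h _ hφ.isSub_ker le_top ?_)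
  by_contra hne
  exact h0 (hS.le_of_inf_ne_bot hφ.isSub_ker (by rwa [inf_comm]))

theorem IsEssential.isIndecomposable {S : Submodule k V.carrier} (hess : V.IsEssential S ⊤)
    (hS : V.IsSimpleSub S) : V.IsIndecomposable := by
  refine ⟨(Submodule.nontrivial_iff k).1 ⟨_, _, hS.2.1⟩, fun A B hA hB hc => ?_⟩
  by_contra! h
  have key {X} (hX : V.IsSub X) (h0 : X ≠ ⊥) : S ≤ X :=
    hS.le_of_inf_ne_bot hX fun h => h0 (hess X hX le_top (by rwa [inf_comm]))
  exact hS.2.1 (le_bot_iff.1 (hc.disjoint (key hA h.1) (key hB h.2)))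

theorem IsEssential.socle_eq {S : Submodule k V.carrier} (hess : V.IsEssential S ⊤)
    (hS : V.IsSimpleSub S) : V.socle = S :=
  socle_eq_of_forall hS fun _ hX => hX.le_of_inf_ne_bot hS.1 fun h0 =>
    hX.2.1 (hess _ hX.1 le_top h0)

variable [IsGradedCoalgebra 𝒞]

theorem isSimple_ofSub {S : Submodule k V.carrier} (hS : V.IsSimpleSub S) :
    (V.ofSub S hS.1).IsSimple := by
  refine (isSimpleSub_map_iff (isHom_incl hS.1) (incl_injective hS.1)).1 ?_
  rwa [Submodule.map_top, range_incl]

/-- The orbit of a nonzero homogeneous element is finite dimensional, and it is graded because every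
functional is a sum of homogeneous ones. A minimal nonzero graded subcomodule of it is simple. -/
theorem exists_isSimpleSub_le {N : Submodule k V.carrier} (hN : V.IsSub N) (h0 : N ≠ ⊥) :
    ∃ S ≤ N, V.IsSimpleSub S ∧ Module.Finite k S := by
  obtain ⟨x, hx, hx0⟩ := Submodule.exists_mem_ne_zero_of_ne_bot h0
  obtain ⟨n, hn⟩ : ∃ n, V.proj n x ≠ 0 := by
    by_contra! h
    exact hx0 (by rw [← V.proj_zero_add_one x, h, h, add_zero])
  rw [isSub_iff] at hN
  obtain ⟨A, hfin, hA, hmem, hrange⟩ := V.finite_range_act (V.proj n x)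
  have hAN : A ≤ N := fun y hy => by
    obtain ⟨f, rfl⟩ := hrange y hy
    exact hN.1 f _ (hN.2 n x hx)
  rw [Comodule.isSub_iff] at hA
  have hsub : V.IsSub A := by
    refine isSub_iff.2 ⟨hA, fun m y hy => ?_⟩
    obtain ⟨f, rfl⟩ := hrange y hy
    obtain ⟨f₀, f₁, h₀, h₁, rfl⟩ := exists_isHomogDual_add (IsGradedCoalgebra.isCompl (𝒞 := 𝒞)) f
    have m0 : V.act f₀ (V.proj n x) ∈ V.gr n := by simpa using V.act_mem h₀ (V.proj_mem n x)
    have m1 := V.act_mem h₁ (V.proj_mem n x)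
    rw [Comodule.act_add, map_add]
    rcases ZMod.two_eq_or m n with rfl | rfl
    · rw [V.proj_of_mem m0, V.proj_of_mem_add_one m1, add_zero]
      exact hA _ _ hmem
    · rw [V.proj_add_one_of_mem m0, V.proj_of_mem m1, zero_add]
      exact hA _ _ hmem
  obtain ⟨S, hSA, hS, hS0, hmin⟩ := Submodule.exists_minimal_of_finite V.IsSub A hsub
    fun h => hn (by simpa [h] using hmem)
  exact ⟨S, hSA.trans hAN, ⟨hS, hS0, hmin⟩, Submodule.finiteDimensional_of_le hSA⟩

theorem IsSimpleSub.finite {S : Submodule k V.carrier} (hS : V.IsSimpleSub S) :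
    Module.Finite k S := by
  obtain ⟨X, hX, hX', hfin⟩ := exists_isSimpleSub_le hS.1 hS.2.1
  rwa [← hS.eq_of_ne_bot hX'.1 hX hX'.2.1]

theorem IsSimple.finite (hV : V.IsSimple) : Module.Finite k V.carrier :=
  have := IsSimpleSub.finite hV
  Module.Finite.equiv (Submodule.topEquiv (R := k) (M := V.carrier))

end simple

/-! ### Injective hulls as direct summands -/

section hull

theorem exists_maximal_isEssential {S : Submodule k V.carrier} (hS : V.IsSub S) :
    ∃ E, V.IsSub E ∧ S ≤ E ∧ V.IsEssential S E ∧
      ∀ E', V.IsSub E' → E ≤ E' → V.IsEssential S E' → E' = E := by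
  obtain ⟨E, hSE, hE⟩ := zorn_le_nonempty₀ {E | V.IsSub E ∧ V.IsEssential S E} (by
    intro c hc hchain y hy
    refine ⟨sSup c, ⟨isSub_sSup fun N hN => (hc hN).1, fun X hX hle h0 => ?_⟩,
      fun z hz => le_sSup hz⟩
    by_contra hne
    obtain ⟨x, hx, hx0⟩ := Submodule.exists_mem_ne_zero_of_ne_bot hne
    obtain ⟨N, hN, hxN⟩ := (Submodule.mem_sSup_of_directed ⟨y, hy⟩ hchain.directedOn).1 (hle hx)
    have := (hc hN).2 (X ⊓ N) (hX.inf (hc hN).1) inf_le_right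
      (le_bot_iff.1 (h0 ▸ inf_le_inf_right S inf_le_left))
    exact hx0 ((Submodule.mem_bot k).1 (this ▸ ⟨hx, hxN⟩))) S
    ⟨hS, fun X _ hle h0 => by rwa [inf_eq_left.2 hle] at h0⟩
  exact ⟨E, hE.prop.1, hSE, hE.prop.2, fun E' h1 h2 h3 => (hE.eq_of_le ⟨h1, h3⟩ h2).symm⟩

theorem exists_maximal_disjoint (V : GradedComodule.{u, v, w} 𝒞) (E : Submodule k V.carrier) :
    ∃ K, V.IsSub K ∧ K ⊓ E = ⊥ ∧ ∀ K', V.IsSub K' → K ≤ K' → K' ⊓ E = ⊥ → K' = K := by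
  obtain ⟨K, -, hK⟩ := zorn_le_nonempty₀ {K | V.IsSub K ∧ K ⊓ E = ⊥} (by
    intro c hc hchain y hy
    refine ⟨sSup c, ⟨isSub_sSup fun N hN => (hc hN).1, ?_⟩, fun z hz => le_sSup hz⟩
    rw [eq_bot_iff]
    rintro x ⟨hx, hxE⟩
    obtain ⟨N, hN, hxN⟩ := (Submodule.mem_sSup_of_directed ⟨y, hy⟩ hchain.directedOn).1 hx
    exact (hc hN).2 ▸ ⟨hxN, hxE⟩) ⊥ ⟨isSub_bot, bot_inf_eq _⟩
  exact ⟨K, hK.prop.1, hK.prop.2, fun E' h1 h2 h3 => (hK.eq_of_le ⟨h1, h3⟩ h2).symm⟩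

variable [IsGradedCoalgebra 𝒞]

/-- Take `E` maximal essential over `S` and `K` maximal with `K ⊓ E = ⊥`. The projection `E ⊕ K → E`
extends to an endomorphism `g` of `V`, and maximality of both forces the image of `g` to be `E`. -/
theorem CoactSplits.exists_hull (h : V.CoactSplits) {S : Submodule k V.carrier}
    (hS : V.IsSub S) : ∃ E, V.IsSub E ∧ S ≤ E ∧ V.IsEssential S E ∧
      ∃ g, V.IsHom V g ∧ LinearMap.range g = E ∧ ∀ x ∈ E, g x = x := by
  obtain ⟨E, hE, hSE, hess, hEmax⟩ := exists_maximal_isEssential hS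
  obtain ⟨K, hK, hKE, hKmax⟩ := exists_maximal_disjoint V E
  obtain ⟨E', hEE', hcompl⟩ := (disjoint_iff.2 hKE).symm.exists_isCompl
  let π := E'.projection K hcompl
  have hπE x (hx : x ∈ E) : π x = x := Submodule.projection_apply_of_mem_left _ (hEE' hx)
  have hπK x (hx : x ∈ K) : π x = 0 := (Submodule.projection_apply_eq_zero_iff _).2 hx
  have hsup := hE.sup hK
  have hf : (V.ofSub _ hsup).IsHom V (π ∘ₗ V.incl _ hsup) := by
    have key (T : V.carrier →ₗ[k] V.carrier) (hTE : ∀ x ∈ E, T x ∈ E) (hTK : ∀ x ∈ K, T x ∈ K)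
        (x) (hx : x ∈ E ⊔ K) : π (T x) = T (π x) := by
      obtain ⟨e, he, κ, hκ, rfl⟩ := Submodule.mem_sup.1 hx
      rw [map_add, map_add, map_add, hπE e he, hπK κ hκ, hπE _ (hTE e he), hπK _ (hTK κ hκ),
        add_zero, add_zero]
    rw [isSub_iff] at hE hK
    refine isHom_iff.2 ⟨fun a x => ?_, fun n x => ?_⟩
    · rw [LinearMap.comp_apply, (isHom_iff.1 (isHom_incl hsup)).1]
      exact key (V.act a) (hE.1 a) (hK.1 a) _ x.2
    · rw [LinearMap.comp_apply, (isHom_iff.1 (isHom_incl hsup)).2]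
      exact key (V.proj n) (hE.2 n) (hK.2 n) _ x.2
  obtain ⟨g, hg, hgx⟩ := h.exists_extension (isHom_incl hsup) (incl_injective hsup) hf
  have hgE x (hx : x ∈ E) : g x = x :=
    (hgx ⟨x, Submodule.mem_sup_left hx⟩).trans (hπE x hx)
  have hgK x (hx : x ∈ K) : g x = 0 :=
    (hgx ⟨x, Submodule.mem_sup_right hx⟩).trans (hπK x hx)
  refine ⟨E, hE, hSE, hess, g, hg, ?_, hgE⟩
  -- The image of `g` is essential over `S`: if `X` lies in it and misses `S`, then `X` misses `E`,
  -- so the preimage of `X` misses `E` and contains `K`. It therefore equals `K`, and `g` kills `K`,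
  -- so `X = ⊥`.
  refine hEmax _ hg.isSub_range (fun x hx => ⟨x, hgE x hx⟩) fun X hX hle h0 => ?_
  have hXE : X ⊓ E = ⊥ := hess _ (hX.inf hE) inf_le_right
    (le_bot_iff.1 (h0 ▸ inf_le_inf_right S inf_le_left))
  have := hKmax (X.comap g) (hX.comap hg) (fun x hx => by
      rw [Submodule.mem_comap, hgK x hx]
      exact X.zero_mem) (by
    rw [eq_bot_iff]
    rintro x ⟨hx, hxE⟩
    rw [SetLike.mem_coe, Submodule.mem_comap, hgE x hxE] at hx
    exact hXE ▸ ⟨hx, hxE⟩)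
  rw [eq_bot_iff]
  intro x hx
  obtain ⟨y, rfl⟩ := hle hx
  exact (Submodule.mem_bot k).2 (hgK y (this ▸ hx))

theorem CoactSplits.of_retract {U : GradedComodule.{u, v, w'} 𝒞} (h : V.CoactSplits)
    {i : U.carrier →ₗ[k] V.carrier} (hi : U.IsHom V i) {r : V.carrier →ₗ[k] U.carrier}
    (hr : V.IsHom U r) (hri : ∀ x, r (i x) = x) : U.CoactSplits := by
  obtain ⟨g, hg, hgx⟩ := h.exists_extension isHom_coact coact_injective hi
  exact ⟨r ∘ₗ g, hr.comp hg, fun x => by rw [LinearMap.comp_apply, hgx, hri]⟩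

theorem CoactSplits.reverse (h : V.CoactSplits) : V.reverse.CoactSplits := by
  obtain ⟨r, hr, hrx⟩ := h
  refine ⟨r, ⟨hr.1, fun n z hz => hr.2 (n + 1) z ?_⟩, hrx⟩
  refine (mem_tensorGrading_iff IsGradedCoalgebra.isCompl).2 fun m f hf => ?_
  rw [add_right_comm]
  exact (mem_tensorGrading_iff IsGradedCoalgebra.isCompl).1 hz m f hf

/-- The hull of any simple subcomodule is a nonzero direct summand, hence everything. -/
theorem IsIndecomposable.socle (hV : V.IsIndecomposable) (h : V.CoactSplits) :
    V.IsSimpleSub V.socle ∧ V.IsEssential V.socle ⊤ := by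
  have := hV.1
  obtain ⟨S, -, hS, -⟩ := exists_isSimpleSub_le (V := V) isSub_top top_ne_bot
  obtain ⟨E, hE, hSE, hess, g, hg, hrange, hgE⟩ := h.exists_hull hS.1
  have htop : E = ⊤ := by
    have hc : IsCompl E (LinearMap.ker g) := by
      constructor
      · rw [Submodule.disjoint_def]
        intro x hx h0
        rw [← hgE x hx, LinearMap.mem_ker.1 h0]
      · rw [codisjoint_iff, eq_top_iff]
        intro x _
        have hgx : g x ∈ E := hrange ▸ ⟨x, rfl⟩
        refine Submodule.mem_sup.2 ⟨g x, hgx, x - g x, ?_, by abel⟩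
        rw [LinearMap.mem_ker, map_sub, hgE _ hgx, sub_self]
    rcases hV.2 _ _ hE hg.isSub_ker hc with h | h
    · exact absurd (le_bot_iff.1 (h ▸ hSE)) hS.2.1
    · have := hc.sup_eq_top
      rwa [h, sup_bot_eq] at this
  have hsoc : V.socle = S := socle_eq_of_forall hS fun X hX => hX.le_of_inf_ne_bot hS.1 fun h0 =>
    hX.2.1 (hess X hX.1 (htop ▸ le_top) h0)
  rw [hsoc, ← htop]
  exact ⟨hS, hess⟩

end hull

end GradedComodule

/-! ### Forgetting the grading; absolute simplicity -/

namespace GradedComodule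

variable {k : Type u} [Field k] {C : Type v} [AddCommGroup C] [Module k C] [Coalgebra k C]
  {𝒞 : ZMod 2 → Submodule k C} {V : GradedComodule.{u, v, w} 𝒞}
  {W : GradedComodule.{u, v, w'} 𝒞}

/-- The part of degree zero of a linear map. -/
noncomputable def evenPart (V : GradedComodule.{u, v, w} 𝒞) (W : GradedComodule.{u, v, w'} 𝒞)
    (φ : V.carrier →ₗ[k] W.carrier) : V.carrier →ₗ[k] W.carrier :=
  W.proj 0 ∘ₗ φ ∘ₗ V.proj 0 + W.proj 1 ∘ₗ φ ∘ₗ V.proj 1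

theorem evenPart_apply (φ : V.carrier →ₗ[k] W.carrier) (x : V.carrier) :
    evenPart V W φ x = W.proj 0 (φ (V.proj 0 x)) + W.proj 1 (φ (V.proj 1 x)) := rfl

theorem evenPart_of_mem (φ : V.carrier →ₗ[k] W.carrier) {n : ZMod 2} {x : V.carrier}
    (hx : x ∈ V.gr n) : evenPart V W φ x = W.proj n (φ x) := by
  rw [evenPart_apply]
  rcases ZMod.two_eq_or n 0 with rfl | rfl
  · rw [V.proj_of_mem hx, V.proj_one_of_mem hx, map_zero, map_zero, add_zero]
  · rw [zero_add] at *
    rw [V.proj_of_mem hx, V.proj_zero_of_mem hx, map_zero, map_zero, zero_add]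

/-- The part of degree one of a linear map. -/
noncomputable def oddPart (V : GradedComodule.{u, v, w} 𝒞) (W : GradedComodule.{u, v, w'} 𝒞)
    (φ : V.carrier →ₗ[k] W.carrier) : V.carrier →ₗ[k] W.carrier :=
  evenPart V W.reverse φ

theorem oddPart_apply (φ : V.carrier →ₗ[k] W.carrier) (x : V.carrier) :
    oddPart V W φ x = W.proj 1 (φ (V.proj 0 x)) + W.proj 0 (φ (V.proj 1 x)) := rfl

theorem evenPart_add_oddPart (φ : V.carrier →ₗ[k] W.carrier) (x : V.carrier) :
    evenPart V W φ x + oddPart V W φ x = φ x := by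
  rw [oddPart_apply, evenPart_apply]
  conv_rhs => rw [← V.proj_zero_add_one x, map_add, ← W.proj_zero_add_one (φ (V.proj 0 x)),
    ← W.proj_zero_add_one (φ (V.proj 1 x))]
  abel

section

variable [IsGradedCoalgebra 𝒞]

theorem isHom_toComodule_of_homog {φ : V.carrier →ₗ[k] W.carrier}
    (h : ∀ m f, IsHomogDual 𝒞 m f → ∀ x, φ (V.act f x) = W.act f (φ x)) :
    V.toComodule.IsHom W.toComodule φ := by
  refine Comodule.isHom_iff.2 fun f x => ?_
  obtain ⟨f₀, f₁, h₀, h₁, rfl⟩ := exists_isHomogDual_add (IsGradedCoalgebra.isCompl (𝒞 := 𝒞)) f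
  rw [Comodule.act_add, Comodule.act_add, map_add, h 0 _ h₀, h 1 _ h₁]

theorem isSub_of_homog {N : Submodule k V.carrier}
    (h : ∀ m f, IsHomogDual 𝒞 m f → ∀ x ∈ N, V.act f x ∈ N)
    (h' : ∀ n, ∀ x ∈ N, V.proj n x ∈ N) : V.IsSub N := by
  refine isSub_iff.2 ⟨fun f x hx => ?_, h'⟩
  obtain ⟨f₀, f₁, h₀, h₁, rfl⟩ := exists_isHomogDual_add (IsGradedCoalgebra.isCompl (𝒞 := 𝒞)) f
  rw [Comodule.act_add]
  exact add_mem (h 0 _ h₀ x hx) (h 1 _ h₁ x hx)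

/-- Homogeneous functionals shift degrees in source and target by the same amount, so they commute
with the degree-preserving part of `φ` by itself. -/
theorem isHom_evenPart {φ : V.carrier →ₗ[k] W.carrier}
    (hφ : V.toComodule.IsHom W.toComodule φ) : V.IsHom W (evenPart V W φ) := by
  rw [Comodule.isHom_iff] at hφ
  refine ⟨isHom_toComodule_of_homog fun m f hf x => ?_, fun n x hx => ?_⟩
  · have key n y (hy : y ∈ V.gr n) :
        evenPart V W φ (V.act f y) = W.act f (evenPart V W φ y) := by
      rw [evenPart_of_mem φ hy, evenPart_of_mem φ (V.act_mem hf hy), hφ, W.act_proj hf]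
    rw [← V.proj_zero_add_one x, map_add, map_add, map_add, map_add,
      key 0 _ (V.proj_mem _ _), key 1 _ (V.proj_mem _ _)]
  · rw [evenPart_of_mem φ hx]
    exact W.proj_mem _ _

theorem isHom_oddPart {φ : V.carrier →ₗ[k] W.carrier}
    (hφ : V.toComodule.IsHom W.toComodule φ) : V.IsHom W.reverse (oddPart V W φ) :=
  isHom_evenPart (W := W.reverse) hφ

theorem IsSimple.iso_or_iso_reverse (hV : V.IsSimple) (hW : W.IsSimple)
    (h : V.toComodule.Iso W.toComodule) : V.Iso W ∨ V.Iso W.reverse := by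
  obtain ⟨e, he⟩ := h
  by_cases h0 : evenPart V W e.toLinearMap = 0
  · right
    refine (isHom_oddPart he).iso (hV.bijective hW.reverse
      (isHom_oddPart he) fun h1 => hV.ne_bot (eq_bot_iff.2 fun x _ => ?_))
    have h1 : oddPart V W e.toLinearMap = 0 := h1
    have := evenPart_add_oddPart (V := V) (W := W) e.toLinearMap x
    rw [h0, h1] at this
    exact e.injective (by simpa using this.symm)
  · exact Or.inl ((isHom_evenPart he).iso (hV.bijective hW (isHom_evenPart he) h0))

/-- Essentiality tested on graded subcomodules implies essentiality for nongraded ones. An element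
of `N` is moved into `S` one homogeneous component at a time, using the graded subcomodules `Y T`
attached to `N`. -/
theorem IsEssential.inf_ne_bot {S : Submodule k V.carrier} (hS : V.IsSub S)
    (h : V.IsEssential S ⊤) {N : Submodule k V.carrier} (hN : V.toComodule.IsSub N)
    (h0 : N ≠ ⊥) : N ⊓ S ≠ ⊥ := by
  intro hNS
  rw [Comodule.isSub_iff] at hN
  have hS' := isSub_iff.1 hS
  have hdisj x (h1 : x ∈ N) (h2 : ∀ i, V.proj i x ∈ S) : x = 0 := by
    have : x ∈ N ⊓ S := ⟨h1, by
      rw [← V.proj_zero_add_one x]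
      exact add_mem (h2 0) (h2 1)⟩
    rwa [hNS, Submodule.mem_bot] at this
  -- Spanned by the components of those elements of `N` whose other component already lies in `T`.
  let Y (T : Submodule k V.carrier) : Submodule k V.carrier :=
    ⨆ i, (N ⊓ T.comap (V.proj (i + 1))).map (V.proj i)
  have memY {T i x} (hx : x ∈ N) (hxT : V.proj (i + 1) x ∈ T) : V.proj i x ∈ Y T :=
    Submodule.mem_iSup_of_mem i ⟨x, ⟨hx, hxT⟩, rfl⟩
  have hY T (hT : V.IsSub T) : V.IsSub (Y T) := by
    rw [isSub_iff] at hT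
    refine isSub_of_homog (fun m f hf => ?_) fun n => ?_
    · refine (iSup_le ?_ : Y T ≤ (Y T).comap (V.act f))
      rintro i _ ⟨x, ⟨hx, hxT⟩, rfl⟩
      rw [Submodule.mem_comap, V.act_proj hf]
      refine memY (hN f x hx) ?_
      rw [add_right_comm, ← V.act_proj hf]
      exact hT.1 f _ hxT
    · refine (iSup_le ?_ : Y T ≤ (Y T).comap (V.proj n))
      rintro i _ ⟨x, ⟨hx, hxT⟩, rfl⟩
      rw [Submodule.mem_comap]
      rcases ZMod.two_eq_or n i with rfl | rfl
      · rw [V.proj_of_mem (V.proj_mem _ _)]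
        exact memY hx hxT
      · rw [V.proj_add_one_of_mem (V.proj_mem _ _)]
        exact zero_mem _
  have memY_iff {T x} (hx : x ∈ Y T) :
      ∃ a ∈ N, ∃ b ∈ N, V.proj 1 a ∈ T ∧ V.proj 0 b ∈ T ∧ x = V.proj 0 a + V.proj 1 b := by
    have : Y T ≤ (N ⊓ T.comap (V.proj 1)).map (V.proj 0) ⊔
        (N ⊓ T.comap (V.proj 0)).map (V.proj 1) := by
      refine iSup_le fun i => ?_
      rcases ZMod.two_eq_or i 0 with rfl | rfl
      · exact le_sup_left
      · exact le_sup_right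
    obtain ⟨_, ⟨a, ⟨ha, ha'⟩, rfl⟩, _, ⟨b, ⟨hb, hb'⟩, rfl⟩, rfl⟩ := Submodule.mem_sup.1 (this hx)
    exact ⟨a, ha, b, hb, ha', hb', rfl⟩
  have proj_mem_of {a b T} (hT : V.IsSub T) (h : V.proj 0 a + V.proj 1 b ∈ T) :
      V.proj 0 a ∈ T ∧ V.proj 1 b ∈ T := by
    have h0 := (isSub_iff.1 hT).2 0 _ h
    have h1 := (isSub_iff.1 hT).2 1 _ h
    rw [map_add, V.proj_of_mem (V.proj_mem _ _), V.proj_zero_of_mem (V.proj_mem _ _),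
      add_zero] at h0
    rw [map_add, V.proj_of_mem (V.proj_mem _ _), V.proj_one_of_mem (V.proj_mem _ _),
      zero_add] at h1
    exact ⟨h0, h1⟩
  have step (T : Submodule k V.carrier) (hT : V.IsSub T) (hne : Y T ≠ ⊥) :
      ∃ a ∈ N, a ≠ 0 ∧ ∃ i, V.proj (i + 1) a ∈ T ∧ V.proj i a ∈ S := by
    by_contra! hcon
    refine hne (h _ (hY T hT) le_top (eq_bot_iff.2 ?_))
    rintro x ⟨hx, hxS⟩
    obtain ⟨a, ha, b, hb, ha', hb', rfl⟩ := memY_iff hx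
    obtain ⟨h0, h1⟩ := proj_mem_of hS hxS
    have ea : a = 0 := by
      by_contra hne
      exact hcon a ha hne 0 (by simpa using ha') h0
    have eb : b = 0 := by
      by_contra hne
      exact hcon b hb hne 1 (by simpa [show (1 + 1 : ZMod 2) = 0 by decide] using hb') h1
    simp [ea, eb]
  obtain ⟨x, hx, hx0⟩ := Submodule.exists_mem_ne_zero_of_ne_bot h0
  have hne1 : Y ⊤ ≠ ⊥ := by
    intro hbot
    refine hx0 ?_
    have this (i : ZMod 2) : V.proj i x = 0 := by
      have := memY (T := ⊤) (i := i) hx trivial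
      rwa [hbot, Submodule.mem_bot] at this
    rw [← V.proj_zero_add_one x, this, this, add_zero]
  -- First round: a nonzero `a` in `N` with one component in `S`. Its other component makes `Y S`
  -- nonzero, for otherwise `a` would lie in `N ⊓ S`. The second round then yields `b` with both
  -- components in `S`.
  obtain ⟨a, ha, ha0, i, -, hi⟩ := step ⊤ isSub_top hne1
  have hi' : V.proj (i + 1 + 1) a ∈ S := by rwa [add_assoc, ZMod.two_add_self, add_zero]
  have hne2 : Y S ≠ ⊥ := by
    intro hbot
    refine ha0 (hdisj a ha fun j => ?_)
    rcases ZMod.two_eq_or j i with rfl | rfl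
    · exact hi
    · have := memY ha hi'
      rw [hbot, Submodule.mem_bot] at this
      rw [this]
      exact zero_mem _
  obtain ⟨b, hb, hb0, j, hj, hj'⟩ := step S hS hne2
  refine hb0 (hdisj b hb fun l => ?_)
  rcases ZMod.two_eq_or l j with rfl | rfl <;> assumption

/-- The largest graded subcomodule inside `N` is zero, so both projections are injective on `N`.
Their images fill `V₀` and `V₁`, so `V` is two copies of `N`, and exchanging the copies reverses the
grading. -/
theorem IsSimple.iso_reverse (hV : V.IsSimple) {N : Submodule k V.carrier}
    (hN : V.toComodule.IsSub N) (hbot : N ≠ ⊥) (htop : N ≠ ⊤) : V.Iso V.reverse := by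
  rw [Comodule.isSub_iff] at hN
  have hinj x (hx : x ∈ N) (h : ∀ i, V.proj i x ∈ N) : x = 0 := by
    let X : Submodule k V.carrier := ⨅ i, N.comap (V.proj i)
    have memX {y} : y ∈ X ↔ ∀ i, V.proj i y ∈ N := by simp [X]
    have hX : V.IsSub X := by
      refine isSub_of_homog (fun m f hf y hy => memX.2 fun i => ?_) fun n y hy =>
        memX.2 fun i => ?_
      · have := V.act_proj hf (i + m) y
        rw [add_assoc, ZMod.two_add_self, add_zero] at this
        rw [← this]
        exact hN f _ (memX.1 hy _)
      · rcases ZMod.two_eq_or i n with rfl | rfl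
        · rw [V.proj_of_mem (V.proj_mem _ _)]
          exact memX.1 hy _
        · rw [V.proj_add_one_of_mem (V.proj_mem _ _)]
          exact zero_mem _
    rcases hV.2.2 X hX le_top with h' | h'
    · exact (Submodule.mem_bot k).1 (h' ▸ memX.2 h)
    · refine absurd (eq_top_iff.2 fun y _ => ?_) htop
      rw [← V.proj_zero_add_one y]
      have hy := memX.1 (h' ▸ trivial : y ∈ X)
      exact add_mem (hy 0) (hy 1)
  have hinj' i x (hx : x ∈ N) (h : V.proj i x = 0) : x = 0 := by
    have hx' := V.proj_add i x
    rw [h, zero_add] at hx'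
    refine hinj x hx fun j => ?_
    rcases ZMod.two_eq_or j i with rfl | rfl
    · rw [h]
      exact zero_mem _
    · rwa [hx']
  let P : (N × N) →ₗ[k] V.carrier := (V.proj 0 ∘ₗ N.subtype).coprod (V.proj 1 ∘ₗ N.subtype)
  have hP a b : P (a, b) = V.proj 0 a + V.proj 1 b := rfl
  have hP0 a b : V.proj 0 (P (a, b)) = V.proj 0 a := by
    rw [hP, map_add, V.proj_of_mem (V.proj_mem _ _), V.proj_zero_of_mem (V.proj_mem _ _), add_zero]
  have hP1 a b : V.proj 1 (P (a, b)) = V.proj 1 b := by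
    rw [hP, map_add, V.proj_of_mem (V.proj_mem _ _), V.proj_one_of_mem (V.proj_mem _ _), zero_add]
  let A (f : Module.Dual k C) (a : N) : N := ⟨V.act f a, hN f a a.2⟩
  have hA0 f (hf : IsHomogDual 𝒞 0 f) a b : V.act f (P (a, b)) = P (A f a, A f b) := by
    rw [hP, hP, map_add, V.act_proj hf, V.act_proj hf, add_zero, add_zero]
  -- Even functionals act diagonally on `N × N` and odd ones act diagonally followed by the swap, so
  -- the swap commutes with both.
  have hA1 f (hf : IsHomogDual 𝒞 1 f) a b : V.act f (P (a, b)) = P (A f b, A f a) := by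
    rw [hP, hP, map_add, V.act_proj hf, V.act_proj hf, zero_add, add_comm,
      show (1 + 1 : ZMod 2) = 0 by decide]
  have hPinj : Function.Injective P := by
    rw [← LinearMap.ker_eq_bot, LinearMap.ker_eq_bot']
    rintro ⟨a, b⟩ h
    have h0 := hP0 a b
    have h1 := hP1 a b
    rw [h, map_zero] at h0 h1
    exact Prod.ext (Subtype.ext (hinj' 0 a a.2 h0.symm)) (Subtype.ext (hinj' 1 b b.2 h1.symm))
  have hsub : V.IsSub (LinearMap.range P) := by
    refine isSub_of_homog ?_ ?_
    · rintro m f hf _ ⟨⟨a, b⟩, rfl⟩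
      rcases ZMod.two_eq_or m 0 with rfl | rfl
      · exact ⟨_, (hA0 f hf a b).symm⟩
      · exact ⟨_, (hA1 f hf a b).symm⟩
    · rintro n _ ⟨⟨a, b⟩, rfl⟩
      rcases ZMod.two_eq_or n 0 with rfl | rfl
      · exact ⟨(a, 0), by rw [hP0, hP]; simp⟩
      · exact ⟨(0, b), by rw [zero_add, hP1, hP]; simp⟩
  have hPsurj : Function.Surjective P := by
    refine LinearMap.range_eq_top.1 (hV.eq_of_ne_bot hsub le_top fun h => ?_)
    rw [LinearMap.range_eq_bot] at h
    obtain ⟨x, hx, hx0⟩ := Submodule.exists_mem_ne_zero_of_ne_bot hbot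
    have := hPinj (a₁ := (⟨x, hx⟩, 0)) (a₂ := 0) (by rw [h]; rfl)
    exact hx0 (congrArg (fun z => (z.1 : V.carrier)) this)
  let E : (N × N) ≃ₗ[k] V.carrier := LinearEquiv.ofBijective P ⟨hPinj, hPsurj⟩
  let u : V.carrier ≃ₗ[k] V.carrier := E.symm ≪≫ₗ LinearEquiv.prodComm k N N ≪≫ₗ E
  have hu a b : u (P (a, b)) = P (b, a) := by
    have : E.symm (P (a, b)) = (a, b) := E.symm_apply_apply (a, b)
    simp only [u, LinearEquiv.trans_apply, this]
    rfl
  refine ⟨u, isHom_toComodule_of_homog (W := V.reverse) fun m f hf x => ?_, fun n x hx => ?_⟩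
  · change u (V.act f x) = V.act f (u x)
    obtain ⟨⟨a, b⟩, rfl⟩ := hPsurj x
    rcases ZMod.two_eq_or m 0 with rfl | rfl
    · rw [hA0 f hf, hu, hu, hA0 f hf]
    · rw [hA1 f hf, hu, hu, hA1 f hf]
  · change u x ∈ V.gr (n + 1)
    obtain ⟨⟨a, b⟩, rfl⟩ := hPsurj x
    rw [hu, hP]
    rcases ZMod.two_eq_or n 0 with rfl | rfl
    · have := hP1 a b
      rw [V.proj_one_of_mem hx] at this
      rw [hinj' 1 b b.2 this.symm, map_zero, zero_add, zero_add]
      exact V.proj_mem _ _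
    · have := hP0 a b
      rw [V.proj_zero_of_mem (by simpa using hx)] at this
      rw [hinj' 0 a a.2 this.symm, map_zero, add_zero]
      exact V.proj_mem _ _

/-- Schur's lemma: an eigenvalue `c` of `α⁻¹ ∘ β` makes the kernel of `β - c • α` a nonzero graded
subcomodule of a simple one. -/
theorem IsSimple.exists_eq_smul [IsAlgClosed k] (hV : V.IsSimple)
    {α β : V.carrier →ₗ[k] W.carrier} (hα : V.IsHom W α) (hβ : V.IsHom W β)
    (hinj : Function.Injective α) (hle : LinearMap.range β ≤ LinearMap.range α) :
    ∃ c : k, β = c • α := by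
  have := hV.finite
  have : Nontrivial V.carrier := (Submodule.nontrivial_iff k).1 ⟨_, _, hV.ne_bot⟩
  let T : V.carrier →ₗ[k] V.carrier := (LinearEquiv.ofInjective α hinj).symm.toLinearMap ∘ₗ
    β.codRestrict _ fun x => hle ⟨x, rfl⟩
  have hT x : α (T x) = β x := congrArg Subtype.val
    ((LinearEquiv.ofInjective α hinj).apply_symm_apply ⟨β x, hle ⟨x, rfl⟩⟩)
  obtain ⟨c, hc⟩ := Module.End.exists_eigenvalue T
  obtain ⟨x, hx, hx0⟩ := hc.exists_hasEigenvector
  refine ⟨c, ?_⟩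
  have hsub := (hβ.sub (hα.smul c)).isSub_ker
  have hxk : x ∈ LinearMap.ker (β - c • α) := by
    rw [Module.End.mem_eigenspace_iff] at hx
    rw [LinearMap.mem_ker, LinearMap.sub_apply, LinearMap.smul_apply, ← hT, hx, map_smul, sub_self]
  have := hV.eq_of_ne_bot hsub le_top fun h => hx0 ((Submodule.mem_bot k).1 (h ▸ hxk))
  exact sub_eq_zero.1 (LinearMap.ker_eq_top.1 this)

theorem IsSimple.not_isSimpleSub_iff [IsAlgClosed k] (hV : V.IsSimple) :
    ¬ V.toComodule.IsSimpleSub ⊤ ↔ V.Iso V.reverse := by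
  constructor
  · intro h
    by_contra hiso
    refine h ⟨Comodule.isSub_top, hV.ne_bot, fun N hN _ => ?_⟩
    by_contra! hcon
    exact hiso (hV.iso_reverse hN hcon.1 hcon.2)
  · rintro ⟨(u : V.carrier ≃ₗ[k] V.carrier), (hu : V.IsHom V.reverse u.toLinearMap)⟩ ⟨-, -, hs⟩
    -- Since `u` has odd degree, `u ∘ u` is a degree-zero endomorphism and hence a scalar, which is
    -- then written as `d * d`.
    obtain ⟨c, hc⟩ := hV.exists_eq_smul isHom_id
      ((reverse_reverse_isHom V).comp (hu.reverse.comp hu)) Function.injective_id (by simp)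
    have huu x : u (u x) = c • x := LinearMap.congr_fun hc x
    obtain ⟨x, -, hx0⟩ := Submodule.exists_mem_ne_zero_of_ne_bot hV.ne_bot
    obtain ⟨n, hn⟩ : ∃ n, V.proj n x ≠ 0 := by
      by_contra! h
      exact hx0 (by rw [← V.proj_zero_add_one x, h, h, add_zero])
    obtain ⟨d, rfl⟩ := IsAlgClosed.exists_eq_mul_self c
    have hd : d ≠ 0 := by
      rintro rfl
      have := huu x
      rw [mul_zero, zero_smul] at this
      exact hx0 (u.injective (u.injective (by simpa using this)))
    set y := V.proj n x with hy
    have hyn : y ∈ V.gr n := V.proj_mem n x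
    have huy : u y ∈ V.gr (n + 1) := hu.2 n y hyn
    let T : V.carrier →ₗ[k] V.carrier := u.toLinearMap - d • LinearMap.id
    have hT : V.toComodule.IsHom V.toComodule T := by
      refine Comodule.isHom_iff.2 fun f z => ?_
      have : u (V.act f z) = V.act f (u z) := Comodule.isHom_iff.1 hu.1 f z
      simp [T, this]
    have hker : V.toComodule.IsSub (LinearMap.ker T) := Comodule.isSub_bot.comap hT
    rcases hs _ hker le_top with h | h
    -- As `(u - d)(u + d) = u² - d² = 0`, this vector lies in the kernel. It is nonzero, in any
    -- characteristic, because its degree-`n` component is `d • y`.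
    · have hmem : u y + d • y ∈ LinearMap.ker T := by
        simp only [T, LinearMap.mem_ker, LinearMap.sub_apply, LinearEquiv.coe_coe,
          LinearMap.smul_apply, LinearMap.id_apply, map_add, map_smul, huu]
        module
      rw [h, Submodule.mem_bot] at hmem
      have : V.proj n (u y + d • y) = d • y := by
        rw [map_add, map_smul, V.proj_of_mem hyn, V.proj_of_mem_add_one huy, zero_add]
      rw [hmem, map_zero] at this
      exact hn ((smul_eq_zero.1 this.symm).resolve_left hd)
    · have : T y = 0 := by
        rw [LinearMap.ker_eq_top.1 h, LinearMap.zero_apply]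
      have h1 : u y = d • y := sub_eq_zero.1 this
      have h2 : u y = 0 := V.disjoint_gr (h1 ▸ Submodule.smul_mem _ _ hyn) huy
      exact hn (u.injective (by rw [h2, map_zero]))

end

theorem gr_reverse_ne [Nontrivial V.carrier] : V.reverse.gr ≠ V.gr := by
  intro h
  have h01 : V.gr 1 = V.gr 0 := congrFun h 0
  exact bot_ne_top (α := Submodule k V.carrier) (by
    rw [← (V.isCompl).sup_eq_top, ← V.isCompl.inf_eq_bot, h01, inf_idem, sup_idem])

theorem finrank_gr_add [Module.Finite k V.carrier] :
    Module.finrank k (V.gr 0) + Module.finrank k (V.gr 1) = Module.finrank k V.carrier :=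
  Submodule.finrank_add_eq_of_isCompl V.isCompl

theorem Iso.finrank_gr (h : V.Iso W) (n : ZMod 2) :
    Module.finrank k (V.gr n) = Module.finrank k (W.gr n) := by
  obtain ⟨e, he⟩ := h
  have : (V.gr n).map e.toLinearMap = W.gr n := by
    refine le_antisymm ?_ fun x hx => ⟨e.symm x, he.symm.2 n x hx, e.apply_symm_apply x⟩
    rintro _ ⟨x, hx, rfl⟩
    exact he.2 n x hx
  rw [← this]
  exact (LinearEquiv.finrank_map_eq e _).symm

theorem finrank_eq_of_iso_reverse [Module.Finite k V.carrier] (h : V.Iso V.reverse) :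
    Module.finrank k V.carrier = 2 * Module.finrank k (V.gr 0) := by
  have : Module.finrank k (V.gr 0) = Module.finrank k (V.gr 1) := h.finrank_gr 0
  rw [← finrank_gr_add, ← this, two_mul]

end GradedComodule

/-! ### The gradings of an indecomposable injective -/

namespace GradedComodule

variable {k : Type u} [Field k] {C : Type v} [AddCommGroup C] [Module k C] [Coalgebra k C]
  {𝒞 : ZMod 2 → Submodule k C} {V : GradedComodule.{u, v, w} 𝒞}
  {W : GradedComodule.{u, v, w'} 𝒞} [IsGradedCoalgebra 𝒞]

theorem IsSimpleSub.not_isAbsolutelySimpleSub_iff [IsAlgClosed k] {S : Submodule k V.carrier}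
    (hS : V.IsSimpleSub S) :
    ¬ V.IsAbsolutelySimpleSub S ↔ (V.ofSub S hS.1).Iso (V.ofSub S hS.1).reverse := by
  rw [← (isSimple_ofSub hS).not_isSimpleSub_iff,
    ← Comodule.isSimpleSub_map_iff (isHom_incl hS.1).1 (incl_injective hS.1), Submodule.map_top,
    range_incl, IsAbsolutelySimpleSub, and_iff_right hS.1]

/-- Since `W` is a copy of `V` as an ungraded comodule, `φ` amounts to an injective endomorphism `θ`
of `V`. The ungraded socle `U` lies in `S`, so it is finite dimensional and `θ` maps it onto itself.
No room in the socle is left for the kernel of `r`. -/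
theorem IsEssential.bijective_of_retract {S : Submodule k V.carrier} (hess : V.IsEssential S ⊤)
    (hS : V.IsSimpleSub S) {e : V.carrier ≃ₗ[k] W.carrier}
    (he : V.toComodule.IsHom W.toComodule e.toLinearMap) {φ : V.carrier →ₗ[k] W.carrier}
    (hφ : V.toComodule.IsHom W.toComodule φ) {r : W.carrier →ₗ[k] V.carrier}
    (hr : W.toComodule.IsHom V.toComodule r) (hrφ : ∀ x, r (φ x) = x) :
    Function.Bijective r := by
  refine ⟨LinearMap.ker_eq_bot.1 ?_, fun x => ⟨φ x, hrφ x⟩⟩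
  by_contra hK
  have := hS.finite
  let θ := e.symm.toLinearMap ∘ₗ φ
  have hθ : V.toComodule.IsHom V.toComodule θ := he.symm.comp hφ
  have hθinj : Function.Injective θ :=
    e.symm.injective.comp (Function.LeftInverse.injective hrφ)
  let U : Submodule k V.carrier := sSup {N | V.toComodule.IsSimpleSub N}
  have hUS : U ≤ S := sSup_le fun N hN => by
    rcases hN.2.2 _ (hN.1.inf hS.1.1) inf_le_left with h | h
    · exact absurd h (hess.inf_ne_bot hS.1 hN.1 hN.2.1)
    · exact inf_eq_left.1 h
  have hθU : U.map θ = U := by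
    have : Module.Finite k U := Submodule.finiteDimensional_of_le hUS
    refine Submodule.eq_of_le_of_finrank_eq ?_ (Submodule.equivMapOfInjective θ hθinj U).finrank_eq.symm
    refine Submodule.map_le_iff_le_comap.2 (sSup_le fun N hN => Submodule.map_le_iff_le_comap.1 ?_)
    exact le_sSup ((Comodule.isSimpleSub_map_iff hθ hθinj).2 hN)
  have hsub : V.toComodule.IsSub ((LinearMap.ker r).map e.symm.toLinearMap) :=
    (Comodule.isSub_bot.comap hr).map he.symm
  have hne : (LinearMap.ker r).map e.symm.toLinearMap ≠ ⊥ := fun h =>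
    hK (Submodule.map_injective_of_injective e.symm.injective (h.trans (Submodule.map_bot _).symm))
  have : Module.Finite k ↥((LinearMap.ker r).map e.symm.toLinearMap ⊓ S) :=
    Submodule.finiteDimensional_of_le inf_le_right
  -- Transported to `V`, the kernel of `r` meets `S` in a finite-dimensional nonzero subcomodule,
  -- which contains an ungraded simple `N ≤ U = θ(U)`; thus the kernel meets the image of `φ`.
  obtain ⟨N, hN, hN'⟩ := Submodule.exists_minimal_of_finite V.toComodule.IsSub _
    (hsub.inf hS.1.1) (hess.inf_ne_bot hS.1 hsub hne)
  obtain ⟨x, hx, hx0⟩ := Submodule.exists_mem_ne_zero_of_ne_bot hN'.2.1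
  have hxU : x ∈ U.map θ := by
    rw [hθU]
    exact (le_sSup hN' : N ≤ U) hx
  obtain ⟨y, -, rfl⟩ := hxU
  obtain ⟨κ, hκ, hκ'⟩ := (hN hx).1
  have : κ = φ y := e.symm.injective hκ'
  rw [this, SetLike.mem_coe, LinearMap.mem_ker, hrφ] at hκ
  exact hx0 (by rw [hκ, map_zero])

/-- The even and odd parts of the isomorphism cannot both vanish on `S`. One that does not is
injective by essentiality, so injectivity of `V` splits it, and the retraction is bijective. -/
theorem IsEssential.iso_or_iso_reverse {V : GradedComodule.{u, v, v} 𝒞}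
    {W : GradedComodule.{u, v, v} 𝒞} {S : Submodule k V.carrier}
    (hess : V.IsEssential S ⊤) (hS : V.IsSimpleSub S) (hinj : V.IsInjective)
    (h : V.toComodule.Iso W.toComodule) : W.Iso V ∨ W.Iso V.reverse := by
  obtain ⟨e, he⟩ := h
  by_cases h0 : S ≤ LinearMap.ker (evenPart V W e.toLinearMap)
  · right
    have h1 : ¬ S ≤ LinearMap.ker (oddPart V W e.toLinearMap) := fun h1 => by
      obtain ⟨x, hx, hx0⟩ := Submodule.exists_mem_ne_zero_of_ne_bot hS.2.1
      have := evenPart_add_oddPart (V := V) (W := W) e.toLinearMap x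
      rw [LinearMap.mem_ker.1 (h0 hx), LinearMap.mem_ker.1 (h1 hx), add_zero] at this
      exact hx0 (e.injective (by simpa using this.symm))
    have hφ := isHom_oddPart he
    obtain ⟨r, hr, hrφ⟩ := hinj _ _ hφ (hess.injective (W := W.reverse) hS hφ h1)
    exact (hr.iso (hess.bijective_of_retract (W := W.reverse) hS he hφ.1 hr.1
      (LinearMap.congr_fun hrφ))).reverse_right
  · left
    have hφ := isHom_evenPart he
    obtain ⟨r, hr, hrφ⟩ := hinj _ _ hφ (hess.injective hS hφ h0)
    exact hr.iso (hess.bijective_of_retract hS he hφ.1 hr.1 (LinearMap.congr_fun hrφ))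

/-- The question reduces to the socle: an isomorphism with the reverse restricts to `S`, and one on
`S` extends because the reverse of `V` is injective too. -/
theorem IsEssential.iso_reverse_iff [IsAlgClosed k] {V : GradedComodule.{u, v, v} 𝒞}
    {S : Submodule k V.carrier} (hess : V.IsEssential S ⊤) (hS : V.IsSimpleSub S)
    (hinj : V.IsInjective) : V.Iso V.reverse ↔ ¬ V.IsAbsolutelySimpleSub S := by
  rw [hS.not_isAbsolutelySimpleSub_iff]
  have hsimple := isSimple_ofSub hS
  constructor
  · rintro ⟨(e : V.carrier ≃ₗ[k] V.carrier), (he : V.IsHom V.reverse e.toLinearMap)⟩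
    have hmap : V.IsSimpleSub (S.map e.toLinearMap) :=
      isSimpleSub_reverse_iff.1 ((isSimpleSub_map_iff he e.injective).2 hS)
    have hle : S.map e.toLinearMap ≤ S := hmap.le_of_inf_ne_bot hS.1 fun h =>
      hmap.2.1 (hess _ hmap.1 le_top h)
    have hmem x : (e.toLinearMap ∘ₗ V.incl S hS.1) x ∈ S := hle ⟨x, x.2, rfl⟩
    let φ := corestrict S hS.1 (e.toLinearMap ∘ₗ V.incl S hS.1) hmem
    have hφ : (V.ofSub S hS.1).IsHom (V.ofSub S hS.1).reverse φ :=
      ⟨isHom_corestrict_toComodule hS.1 (he.comp (isHom_incl hS.1)).1 hmem,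
        (he.comp (isHom_incl hS.1)).2⟩
    refine hφ.iso (hsimple.bijective hsimple.reverse hφ fun h => hsimple.ne_bot ?_)
    refine eq_bot_iff.2 fun x _ => ?_
    have : e (x : V.carrier) = 0 := congrArg (V.incl S hS.1) (LinearMap.congr_fun h x)
    exact Subtype.ext (e.injective (by rw [this]; exact (map_zero e).symm))
  · rintro ⟨e, he⟩
    have hf : (V.ofSub S hS.1).IsHom V.reverse (V.incl S hS.1 ∘ₗ e.toLinearMap) :=
      (isHom_incl hS.1).reverse.comp he
    obtain ⟨g, hg, hgx⟩ := hinj.coactSplits.reverse.exists_extension (isHom_incl hS.1)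
      (incl_injective hS.1) hf
    have h0 : ¬ S ≤ LinearMap.ker g := fun h => by
      obtain ⟨x, hx, hx0⟩ := Submodule.exists_mem_ne_zero_of_ne_bot hS.2.1
      have h1 := hgx ⟨x, hx⟩
      have h2 : g x = 0 := h hx
      have h3 : V.incl S hS.1 (e ⟨x, hx⟩) = 0 := h1.symm.trans h2
      have h4 := incl_injective hS.1 (h3.trans (map_zero _).symm)
      exact hx0 (congrArg Subtype.val (e.injective (h4.trans (map_zero e).symm)))
    obtain ⟨r, hr, hrg⟩ := hinj _ _ hg (hess.injective hS hg h0)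
    -- The identity is an ungraded isomorphism of `V` with its reverse.
    refine (hr.iso (hess.bijective_of_retract (W := V.reverse) (e := LinearEquiv.refl k _) hS
      isHom_id.1 hg.1 hr.1 (LinearMap.congr_fun hrg))).symm

end GradedComodule

namespace GradedComodule

variable {k : Type u} [Field k] {C : Type v} [AddCommGroup C] [Module k C] [Coalgebra k C]
  {𝒞 : ZMod 2 → Submodule k C} {V : GradedComodule.{u, v, w} 𝒞}
  {W : GradedComodule.{u, v, w'} 𝒞} [IsGradedCoalgebra 𝒞]

/-! ### Homomorphisms to the coalgebra and functionals -/

section functional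

/-- The homomorphism `V ⊗ C → C` given by a functional on `V`. -/
noncomputable def functionalMap (V : GradedComodule.{u, v, w} 𝒞)
    (ψ : V.carrier →ₗ[k] k) : V.cofree.carrier →ₗ[k] (regular 𝒞).carrier :=
  (TensorProduct.lid k C).toLinearMap ∘ₗ ψ.rTensor C

theorem functionalMap_lTensor (ψ : V.carrier →ₗ[k] k) (h : C →ₗ[k] C) (z : V.carrier ⊗[k] C) :
    V.functionalMap ψ (h.lTensor V.carrier z) = h (V.functionalMap ψ z) := by
  change (TensorProduct.lid k C) (ψ.rTensor C (h.lTensor _ z)) =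
    h ((TensorProduct.lid k C) (ψ.rTensor C z))
  induction z with
  | zero => simp
  | tmul v c => simp
  | add x y hx hy => simp only [map_add, hx, hy]

theorem isHom_functionalMap {ψ : V.carrier →ₗ[k] k} (hψ : V.gr 1 ≤ LinearMap.ker ψ) :
    V.cofree.IsHom (regular 𝒞) (V.functionalMap ψ) := by
  refine ⟨Comodule.isHom_iff.2 fun f z => ?_, fun n => ?_⟩
  · rw [cofree_act, functionalMap_lTensor]
    rfl
  · refine (iSup_le fun a => Submodule.map₂_le.2 ?_ : tensorGrading V.gr 𝒞 n ≤
      (𝒞 n).comap ((TensorProduct.lid k C).toLinearMap ∘ₗ ψ.rTensor C))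
    intro v hv c hc
    rw [Submodule.mem_comap]
    simp only [TensorProduct.mk_apply, LinearMap.comp_apply, LinearMap.rTensor_tmul,
      LinearEquiv.coe_coe, TensorProduct.lid_tmul]
    rcases ZMod.two_eq_or a 0 with rfl | rfl
    · rw [sub_zero] at hc
      exact Submodule.smul_mem _ _ hc
    · rw [LinearMap.mem_ker.1 (hψ hv), zero_smul]
      exact zero_mem _

theorem counit_actSelf (f : Module.Dual k C) (c : C) :
    CoalgebraStruct.counit (R := k) (Comodule.actSelf f c) = f c := by
  have key (z : C ⊗[k] C) : CoalgebraStruct.counit (R := k) (slice f z) =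
      f (TensorProduct.lid k C ((CoalgebraStruct.counit (R := k) (A := C)).rTensor C z)) := by
    induction z with
    | zero => simp
    | tmul v c => simp [mul_comm]
    | add x y hx hy => simp only [map_add, hx, hy]
  rw [Comodule.actSelf, LinearMap.comp_apply, key, Coalgebra.rTensor_counit_comul]
  simp

/-- The retraction of the comultiplication is counit tensor identity; it has degree zero because the
counit kills `𝒞 1`. -/
theorem coactSplits_regular : (regular 𝒞).CoactSplits := by
  refine ⟨(regular 𝒞).functionalMap (CoalgebraStruct.counit (R := k) (A := C)),
    isHom_functionalMap fun x hx => IsGradedCoalgebra.counit_eq_zero (𝒞 := 𝒞) x hx, fun x => ?_⟩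
  have key (c : C) : (TensorProduct.lid k C) ((CoalgebraStruct.counit (R := k) (A := C)).rTensor C
      (CoalgebraStruct.comul (R := k) c)) = c := by
    rw [Coalgebra.rTensor_counit_comul]
    simp
  exact key x

/-- The homomorphism `V → C` given by a functional on `V`. -/
noncomputable def ofFunctional (V : GradedComodule.{u, v, w} 𝒞)
    (ψ : V.carrier →ₗ[k] k) : V.carrier →ₗ[k] (regular 𝒞).carrier :=
  V.functionalMap ψ ∘ₗ V.coact

theorem isHom_ofFunctional {ψ : V.carrier →ₗ[k] k} (hψ : V.gr 1 ≤ LinearMap.ker ψ) :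
    V.IsHom (regular 𝒞) (V.ofFunctional ψ) :=
  (isHom_functionalMap hψ).comp isHom_coact

theorem counit_ofFunctional (ψ : V.carrier →ₗ[k] k) (x : V.carrier) :
    CoalgebraStruct.counit (R := k) (A := C) (V.ofFunctional ψ x) = ψ x := by
  have key (z : V.carrier ⊗[k] C) : CoalgebraStruct.counit (R := k) (A := C)
      (TensorProduct.lid k C (ψ.rTensor C z)) =
      ψ (slice (CoalgebraStruct.counit (R := k) (A := C)) z) := by
    induction z with
    | zero => simp
    | tmul v c => simp [mul_comm]
    | add x y hx hy => simp only [map_add, hx, hy]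
  exact (key _).trans (congrArg ψ (V.act_counit x))

/-- A homomorphism `γ` to `C` is recovered from its counit: `f (γ x)` is the counit of `γ (V.act f
x)` for each functional `f`. -/
theorem eq_of_counit_eq {α β : V.carrier →ₗ[k] (regular 𝒞).carrier}
    (hα : V.IsHom (regular 𝒞) α) (hβ : V.IsHom (regular 𝒞) β)
    (h : ∀ x, CoalgebraStruct.counit (R := k) (A := C) (α x) =
      CoalgebraStruct.counit (R := k) (A := C) (β x)) : α = β := by
  refine LinearMap.ext fun x => ?_
  refine (Module.forall_dual_apply_eq_zero_iff k (α x - β x)).1 (fun f => ?_) |> sub_eq_zero.1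
  have key {γ : V.carrier →ₗ[k] (regular 𝒞).carrier} (hγ : V.IsHom (regular 𝒞) γ) (f) (x) :
      f (γ x) = CoalgebraStruct.counit (R := k) (A := C) (γ (V.act f x)) :=
    (counit_actSelf f _).symm.trans (congrArg _ (Comodule.isHom_iff.1 hγ.1 f x).symm)
  exact (map_sub f (α x) (β x)).trans
    (sub_eq_zero.2 ((key hα f x).trans ((h _).trans (key hβ f x).symm)))

theorem IsHom.counit_eq_zero {α : V.carrier →ₗ[k] (regular 𝒞).carrier}
    (hα : V.IsHom (regular 𝒞) α) {x : V.carrier} (hx : x ∈ V.gr 1) :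
    CoalgebraStruct.counit (R := k) (A := C) (α x) = 0 :=
  IsGradedCoalgebra.counit_eq_zero (𝒞 := 𝒞) _ (hα.2 1 x hx)

theorem exists_isHom_regular_ne_zero {x : V.carrier} (hx : x ∈ V.gr 0) (h0 : x ≠ 0) :
    ∃ φ, V.IsHom (regular 𝒞) φ ∧ φ ≠ 0 := by
  obtain ⟨f, hf⟩ : ∃ f : Module.Dual k V.carrier, f x ≠ 0 := by
    by_contra! h
    exact h0 ((Module.forall_dual_apply_eq_zero_iff k x).1 h)
  refine ⟨V.ofFunctional (f ∘ₗ V.proj 0), isHom_ofFunctional fun y hy => ?_, fun h => hf ?_⟩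
  · rw [LinearMap.mem_ker, LinearMap.comp_apply, V.proj_zero_of_mem hy, map_zero]
  · rw [← V.proj_of_mem hx, ← LinearMap.comp_apply, ← counit_ofFunctional, h]
    exact map_zero _

end functional

/-! ### Existence of cover families inside the coalgebra -/

section subobjects

theorem iso_ofSub_of_map_eq {φ : V.carrier →ₗ[k] W.carrier} (hφ : V.IsHom W φ)
    (hinj : Function.Injective φ) {N : Submodule k V.carrier} {N' : Submodule k W.carrier}
    (hN : V.IsSub N) (hN' : W.IsSub N') (h : N.map φ = N') :
    (V.ofSub N hN).Iso (W.ofSub N' hN') := by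
  subst h
  have hm (x : (V.ofSub N hN).carrier) : (φ ∘ₗ V.incl N hN) x ∈ N.map φ := ⟨x, x.2, rfl⟩
  refine (isHom_corestrict hN' (hφ.comp (isHom_incl hN)) hm).iso ⟨fun x y h => ?_, ?_⟩
  · exact incl_injective hN (hinj (congrArg (W.incl _ hN') h))
  · rintro ⟨_, x, hx, rfl⟩
    exact ⟨⟨x, hx⟩, rfl⟩

theorem iso_ofSub_range {φ : V.carrier →ₗ[k] W.carrier} (hφ : V.IsHom W φ)
    (hinj : Function.Injective φ) {N : Submodule k W.carrier} (hN : W.IsSub N)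
    (h : LinearMap.range φ = N) : V.Iso (W.ofSub N hN) := by
  subst h
  refine (isHom_corestrict hN hφ fun x => ⟨x, rfl⟩).iso ⟨fun x y h => ?_, ?_⟩
  · exact hinj (congrArg (W.incl _ hN) h)
  · rintro ⟨_, x, rfl⟩
    exact ⟨x, rfl⟩

theorem isoSub_iff {U : Comodule.{u, v, w'} k C} {N : Submodule k V.carrier} (hN : V.IsSub N) :
    U.IsoSub V.toComodule N ↔ U.Iso (V.ofSub N hN).toComodule := by
  constructor
  · rintro ⟨φ, hφ, hinj, rfl⟩
    refine ⟨LinearEquiv.ofInjective φ hinj, ?_⟩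
    exact isHom_corestrict_toComodule hN hφ fun x => ⟨x, rfl⟩
  · rintro ⟨e, he⟩
    refine ⟨V.incl N hN ∘ₗ e.toLinearMap, (isHom_incl hN).1.comp he,
      (incl_injective hN).comp e.injective, ?_⟩
    rw [LinearMap.range_comp, LinearEquiv.range, Submodule.map_top, range_incl]

/-- After reversing if necessary, `V` has a nonzero element of degree zero, hence a nonzero map to
`C`. This is why only the ungraded isomorphism type is controlled. -/
theorem IsSimple.exists_iso_ofSub_regular (hV : V.IsSimple) :
    ∃ (N : Submodule k (regular 𝒞).carrier) (hN : (regular 𝒞).IsSimpleSub N),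
      V.toComodule.Iso ((regular 𝒞).ofSub N hN.1).toComodule := by
  obtain ⟨x, -, hx0⟩ := Submodule.exists_mem_ne_zero_of_ne_bot hV.ne_bot
  by_cases h : V.proj 0 x = 0
  · have h1 : V.proj 1 x ≠ 0 := fun h1 => hx0 (by rw [← V.proj_zero_add_one x, h, h1, add_zero])
    obtain ⟨φ, hφ, h0⟩ := exists_isHom_regular_ne_zero (V := V.reverse)
      (V.proj_mem 1 x) h1
    exact ⟨_, hV.reverse.isSimpleSub_range hφ h0,
      (iso_ofSub_range hφ (hV.reverse.injective hφ h0) _ rfl).toComodule⟩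
  · obtain ⟨φ, hφ, h0⟩ := exists_isHom_regular_ne_zero (V.proj_mem 0 x) h
    exact ⟨_, hV.isSimpleSub_range hφ h0,
      (iso_ofSub_range hφ (hV.injective hφ h0) _ rfl).toComodule⟩

theorem CoactSplits.exists_injective_hull (h : V.CoactSplits) {S : Submodule k V.carrier}
    (hS : V.IsSimpleSub S) : ∃ I : GradedComodule.{u, v, w} 𝒞,
      I.IsIndecomposable ∧ I.CoactSplits ∧ I.Embeds V ∧ ∃ hI : I.IsSimpleSub I.socle,
      (I.ofSub I.socle hI.1).Iso (V.ofSub S hS.1) := by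
  obtain ⟨E, hE, hSE, hess, g, hg, hrange, hgE⟩ := h.exists_hull hS.1
  have hi := isHom_incl hE
  have hinj := incl_injective hE
  have hmap : (S.comap (V.incl E hE)).map (V.incl E hE) = S := by
    rw [Submodule.map_comap_eq, range_incl, inf_eq_right.2 hSE]
  have hS' : (V.ofSub E hE).IsSimpleSub (S.comap (V.incl E hE)) := by
    rwa [← isSimpleSub_map_iff hi hinj, hmap]
  have hess' : (V.ofSub E hE).IsEssential (S.comap (V.incl E hE)) ⊤ := by
    intro X hX _ h0
    refine Submodule.map_injective_of_injective hinj ((hess _ (hX.map hi) ?_ ?_).trans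
      (Submodule.map_bot _).symm)
    · exact LinearMap.map_le_range.trans (range_incl hE).le
    · rw [← hmap, ← Submodule.map_inf _ hinj, h0, Submodule.map_bot]
  have hsoc := hess'.socle_eq hS'
  have hS'' : (V.ofSub E hE).IsSimpleSub (V.ofSub E hE).socle := by rwa [hsoc]
  exact ⟨V.ofSub E hE, hess'.isIndecomposable hS',
    h.of_retract hi (isHom_corestrict hE hg fun x => hrange ▸ ⟨x, rfl⟩)
      fun x => Subtype.ext (hgE x x.2),
    ⟨_, hi, hinj⟩, hS'', iso_ofSub_of_map_eq hi hinj _ _ (by rw [hsoc, hmap])⟩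

theorem exists_isCoverFamily (𝒞 : ZMod 2 → Submodule k C) [IsGradedCoalgebra 𝒞] :
    ∃ (ι : Type v) (I : ι → GradedComodule.{u, v, v} 𝒞),
      IsCoverFamily I ∧ ∀ i, (I i).Embeds (regular 𝒞) := by
  -- The index set consists of the simple graded subcomodules of `C` up to ungraded isomorphism,
  -- with a hull in `C` of one representative per class.
  let s : Setoid {N : Submodule k (regular 𝒞).carrier // (regular 𝒞).IsSimpleSub N} :=
    { r N N' := ((regular 𝒞).ofSub N.1 N.2.1).toComodule.Iso
        ((regular 𝒞).ofSub N'.1 N'.2.1).toComodule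
      iseqv := ⟨fun N => ⟨LinearEquiv.refl k _, isHom_id.1⟩, Comodule.Iso.symm,
        Comodule.Iso.trans⟩ }
  choose I hind hsplit hemb hsoc hiso using fun i : Quotient s =>
    (coactSplits_regular (𝒞 := 𝒞)).exists_injective_hull i.out.2
  refine ⟨Quotient s, I, ⟨hind, fun i => (hsplit i).isInjective, hsoc, fun S hS => ?_⟩, hemb⟩
  obtain ⟨N, hN, h⟩ := hS.exists_iso_ofSub_regular
  refine ⟨⟦⟨N, hN⟩⟧, ?_, fun i hi => ?_⟩
  · refine (isoSub_iff (hsoc _).1).2 (h.trans ?_)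
    have : (⟨N, hN⟩ : {N // (regular 𝒞).IsSimpleSub N}) ≈ (⟦⟨N, hN⟩⟧ : Quotient s).out :=
      Setoid.symm (Quotient.mk_out _)
    exact Comodule.Iso.trans this (hiso _).symm.toComodule
  · rw [← Quotient.out_eq i]
    refine Quotient.sound ?_
    exact ((((isoSub_iff (hsoc i).1).1 hi).trans (hiso i).toComodule).symm.trans h :)

end subobjects

end GradedComodule

namespace GradedComodule

variable {k : Type u} [Field k] {C : Type v} [AddCommGroup C] [Module k C] [Coalgebra k C]
  {𝒞 : ZMod 2 → Submodule k C}

/-! ### Direct sums of comodules with split coaction -/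

section directSum

variable {J : Type w'} {W : J → GradedComodule.{u, v, w} 𝒞}

open scoped Classical in
/-- The inclusion of a summand of a direct sum. -/
noncomputable def dsIncl (W : J → GradedComodule.{u, v, w} 𝒞) (j : J) :
    (W j).carrier →ₗ[k] (directSum W).carrier :=
  DirectSum.lof k J (fun j => (W j).carrier) j

/-- The projection of a direct sum to a summand. -/
noncomputable def dsProj (W : J → GradedComodule.{u, v, w} 𝒞) (j : J) :
    (directSum W).carrier →ₗ[k] (W j).carrier :=
  DirectSum.component k J (fun j => (W j).carrier) j

theorem dsProj_dsIncl (j : J) (x : (W j).carrier) : dsProj W j (dsIncl W j x) = x := by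
  classical
  exact DirectSum.component.lof_self (R := k) (M := fun j => (W j).carrier) j x

theorem dsProj_dsIncl_of_ne {i j : J} (h : i ≠ j) (x : (W i).carrier) :
    dsProj W j (dsIncl W i x) = 0 := by
  classical
  refine (DirectSum.component.of (R := k) (M := fun j => (W j).carrier) j i x).trans ?_
  rw [dif_neg h]

theorem directSum_ext {x y : (directSum W).carrier} (h : ∀ j, dsProj W j x = dsProj W j y) :
    x = y :=
  DFinsupp.ext h

theorem directSum_hom_ext {M : Type*} [AddCommGroup M] [Module k M]
    {f g : (directSum W).carrier →ₗ[k] M} (h : ∀ j x, f (dsIncl W j x) = g (dsIncl W j x)) :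
    f = g := by
  classical
  exact DirectSum.linearMap_ext k fun j => LinearMap.ext (h j)

theorem exists_directSum_lift {M : Type*} [AddCommGroup M] [Module k M]
    (f : ∀ j, (W j).carrier →ₗ[k] M) :
    ∃ F : (directSum W).carrier →ₗ[k] M, ∀ j x, F (dsIncl W j x) = f j x := by
  classical
  exact ⟨DirectSum.toModule k J M f, fun j x =>
    DirectSum.toModule_lof (R := k) (M := fun j => (W j).carrier) (φ := f) j x⟩

theorem isHom_dsIncl (j : J) : (W j).IsHom (directSum W) (dsIncl W j) :=
  ⟨directSumCoact_comp_lof W j, fun n x hx => by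
    classical
    exact (le_iSup (fun i => ((W i).gr n).map (DirectSum.lof k J (fun j => (W j).carrier) i)) j)
      ⟨x, hx, rfl⟩⟩

theorem isHom_dsProj (j : J) : (directSum W).IsHom (W j) (dsProj W j) := by
  classical
  have key (T : (directSum W).carrier →ₗ[k] (directSum W).carrier)
      (t : ∀ i, (W i).carrier →ₗ[k] (W i).carrier)
      (h : ∀ i x, T (dsIncl W i x) = dsIncl W i (t i x)) :
      dsProj W j ∘ₗ T = t j ∘ₗ dsProj W j := by
    refine directSum_hom_ext fun i x => ?_
    rw [LinearMap.comp_apply, LinearMap.comp_apply, h]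
    by_cases hij : i = j
    · subst hij
      rw [dsProj_dsIncl, dsProj_dsIncl]
    · rw [dsProj_dsIncl_of_ne hij, dsProj_dsIncl_of_ne hij, map_zero]
  exact isHom_iff.2 ⟨fun f => LinearMap.congr_fun (key _ _ fun i x =>
      ((isHom_iff.1 (isHom_dsIncl i)).1 f x).symm),
    fun n => LinearMap.congr_fun (key _ _ fun i x =>
      ((isHom_iff.1 (isHom_dsIncl i)).2 n x).symm)⟩

theorem eq_sum_dsIncl {d : ℕ} {emb : Fin d → J} (hemb : Function.Injective emb)
    {x : (directSum W).carrier} (h : ∀ j, j ∉ Set.range emb → dsProj W j x = 0) :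
    x = ∑ b, dsIncl W (emb b) (dsProj W (emb b) x) := by
  refine directSum_ext fun j => ?_
  rw [map_sum]
  by_cases hj : j ∈ Set.range emb
  · obtain ⟨b, rfl⟩ := hj
    rw [Finset.sum_eq_single b, dsProj_dsIncl]
    · exact fun b' _ hb' => dsProj_dsIncl_of_ne (fun h => hb' (hemb h)) _
    · simp
  · rw [h j hj, Finset.sum_eq_zero]
    exact fun b _ => dsProj_dsIncl_of_ne (fun h => hj ⟨b, h⟩) _

theorem exists_tensor_lift {M : Type*} [AddCommGroup M] [Module k M]
    (f : ∀ j, (W j).carrier ⊗[k] C →ₗ[k] M) :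
    ∃ F : (directSum W).carrier ⊗[k] C →ₗ[k] M,
      ∀ j z, F ((dsIncl W j).rTensor C z) = f j z := by
  classical
  let F : (directSum W).carrier ⊗[k] C →ₗ[k] M := DirectSum.toModule k J M f ∘ₗ
    (TensorProduct.directSumLeft k k (fun j => (W j).carrier) C).toLinearMap
  refine ⟨F, fun j z => ?_⟩
  induction z with
  | zero => simp
  | add x y hx hy => rw [map_add, map_add, map_add, hx, hy]
  | tmul v c =>
    have := TensorProduct.directSumLeft_tmul_lof (S := k) (R := k) (M₁ := fun j => (W j).carrier)
      j v c
    rw [LinearMap.rTensor_tmul]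
    exact (congrArg (DirectSum.toModule k J M f) this).trans
      (DirectSum.toModule_lof (R := k) (φ := f) j _)

variable [IsGradedCoalgebra 𝒞]

/-- Tensoring with `C` commutes with direct sums, so the retractions of the summands add up to one
of the sum, whatever the index set. -/
theorem CoactSplits.directSum (h : ∀ j, (W j).CoactSplits) : (directSum W).CoactSplits := by
  choose r hr hrx using h
  obtain ⟨R, hR⟩ := exists_tensor_lift fun j => dsIncl W j ∘ₗ r j
  have hR' j v c : R (dsIncl W j v ⊗ₜ c) = dsIncl W j (r j (v ⊗ₜ c)) := hR j (v ⊗ₜ c)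
  refine ⟨R, ⟨Comodule.isHom_iff.2 fun f z => ?_, fun n => ?_⟩, fun x => ?_⟩
  · rw [cofree_act]
    have : R ∘ₗ (Comodule.actSelf f).lTensor (GradedComodule.directSum W).carrier =
        (GradedComodule.directSum W).act f ∘ₗ R := by
      refine TensorProduct.ext (directSum_hom_ext fun j v => LinearMap.ext fun c => ?_)
      have h1 := Comodule.isHom_iff.1 (hr j).1 f (v ⊗ₜ c)
      rw [cofree_act, LinearMap.lTensor_tmul] at h1
      have h2 := Comodule.isHom_iff.1 (isHom_dsIncl (W := W) j).1 f (r j (v ⊗ₜ c))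
      have h3 := hR' j v (Comodule.actSelf f c)
      rw [h1, h2, ← hR'] at h3
      exact h3
    exact LinearMap.congr_fun this z
  · refine (iSup_le fun a => Submodule.map₂_le.2 ?_ :
      tensorGrading (GradedComodule.directSum W).gr 𝒞 n ≤
        ((GradedComodule.directSum W).gr n).comap R)
    intro v hv c hc
    refine (iSup_le ?_ : (GradedComodule.directSum W).gr a ≤
      ((GradedComodule.directSum W).gr n).comap
        (R ∘ₗ (TensorProduct.mk k (GradedComodule.directSum W).carrier C).flip c)) hv
    rintro j _ ⟨y, hy, rfl⟩
    change R (dsIncl W j y ⊗ₜ c) ∈ (GradedComodule.directSum W).gr n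
    rw [hR']
    exact (isHom_dsIncl j).2 n _ ((hr j).2 n _ (tmul_mem_tensorGrading (by ring) hy hc))
  · have : R ∘ₗ (GradedComodule.directSum W).coact = LinearMap.id := by
      refine directSum_hom_ext fun j x => ?_
      have h1 : (GradedComodule.directSum W).coact (dsIncl W j x) =
          (dsIncl W j).rTensor C ((W j).coact x) :=
        LinearMap.congr_fun (isHom_dsIncl (W := W) j).1 x
      rw [LinearMap.comp_apply, h1, hR, LinearMap.comp_apply, hrx, LinearMap.id_apply]
    exact LinearMap.congr_fun this x

end directSum

/-! ### Functionals dual to the degree-zero part of the socle -/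

section dual

variable {V : GradedComodule.{u, v, w} 𝒞} {S : GradedComodule.{u, v, w'} 𝒞}

/-- The functionals `ψ b` vanish in degree one and restrict to a basis of the dual of the degree
zero part of the socle. -/
structure IsSocleDualBasis (V : GradedComodule.{u, v, w} 𝒞) {d : ℕ}
    (ψ : Fin d → V.carrier →ₗ[k] k) : Prop where
  le_ker : ∀ b, V.gr 1 ≤ LinearMap.ker (ψ b)
  eq_zero : ∀ c : Fin d → k, (∀ x ∈ V.socle ⊓ V.gr 0, ∑ b, c b * ψ b x = 0) → c = 0
  exists_eq : ∀ χ : V.carrier →ₗ[k] k, ∃ c : Fin d → k, ∀ x ∈ V.socle ⊓ V.gr 0,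
    χ x = ∑ b, c b * ψ b x

theorem exists_isSocleDualBasis {d : ℕ} [Module.Finite k V.socle]
    (hd : Module.finrank k ↥(V.socle ⊓ V.gr 0) = d) :
    ∃ ψ : Fin d → V.carrier →ₗ[k] k, V.IsSocleDualBasis ψ := by
  have : Module.Finite k ↥(V.socle ⊓ V.gr 0) := Submodule.finiteDimensional_of_le inf_le_left
  let e := Module.finBasisOfFinrankEq k ↥(V.socle ⊓ V.gr 0) hd
  obtain ⟨l, hl⟩ := (V.socle ⊓ V.gr 0).subtype.exists_leftInverse_of_injective
    (Submodule.ker_subtype _)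
  have hl' (x : ↥(V.socle ⊓ V.gr 0)) : l x = x := LinearMap.congr_fun hl x
  let ψ (b : Fin d) : V.carrier →ₗ[k] k := e.coord b ∘ₗ l ∘ₗ V.proj 0
  have hψ (b) (x : ↥(V.socle ⊓ V.gr 0)) : ψ b x = e.repr x b := by
    simp only [ψ, LinearMap.comp_apply, V.proj_of_mem x.2.2, hl', Module.Basis.coord_apply]
  refine ⟨ψ, fun b x hx => ?_, fun c hc => ?_, fun χ => ⟨fun b => χ (e b), fun x hx => ?_⟩⟩
  · simp only [ψ, LinearMap.mem_ker, LinearMap.comp_apply, V.proj_zero_of_mem hx, map_zero]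
  · funext a
    have := hc (e a) (e a).2
    simpa [hψ, Finsupp.single_apply] using this
  · conv_lhs => rw [show x = ((⟨x, hx⟩ : ↥(V.socle ⊓ V.gr 0)) : V.carrier) from rfl,
      ← e.sum_repr ⟨x, hx⟩]
    rw [Submodule.coe_sum, map_sum]
    refine Finset.sum_congr rfl fun b _ => ?_
    rw [Submodule.coe_smul, map_smul, smul_eq_mul, mul_comm]
    exact congrArg _ (hψ b ⟨x, hx⟩).symm

theorem IsSimple.range_le_socle (hS : S.IsSimple) {θ : S.carrier →ₗ[k] V.carrier}
    (hθ : S.IsHom V θ) : LinearMap.range θ ≤ V.socle := by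
  by_cases h : θ = 0
  · rw [h, LinearMap.range_zero]
    exact bot_le
  · exact (hS.isSimpleSub_range hθ h).le_socle

theorem IsSimple.range_eq_socle (hS : S.IsSimple) (hV : V.IsSimpleSub V.socle)
    {θ : S.carrier →ₗ[k] V.carrier} (hθ : S.IsHom V θ) (h0 : θ ≠ 0) :
    LinearMap.range θ = V.socle :=
  hV.eq_of_ne_bot hθ.isSub_range (hS.range_le_socle hθ) (by rwa [ne_eq, LinearMap.range_eq_bot])

variable [IsGradedCoalgebra 𝒞]

theorem IsSimple.iso_ofSub_socle (hS : S.IsSimple) (hV : V.IsSimpleSub V.socle)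
    {θ : S.carrier →ₗ[k] V.carrier} (hθ : S.IsHom V θ) (h0 : θ ≠ 0) :
    S.Iso (V.ofSub V.socle hV.1) :=
  iso_ofSub_range hθ (hS.injective hθ h0) _ (hS.range_eq_socle hV hθ h0)

/-- Used for injectivity within one block of copies of `V`. If some `θ a` is nonzero, Schur's lemma
makes every `θ b` a multiple of it, and the relation becomes a linear dependence of the `ψ b` on the
socle. -/
theorem IsSocleDualBasis.hom_eq_zero [IsAlgClosed k] {d : ℕ} {ψ : Fin d → V.carrier →ₗ[k] k}
    (hψ : V.IsSocleDualBasis ψ) (hV : V.IsSimpleSub V.socle) (hS : S.IsSimple)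
    {θ : Fin d → S.carrier →ₗ[k] V.carrier} (hθ : ∀ b, S.IsHom V (θ b))
    (h : ∀ x, ∑ b, ψ b (θ b x) = 0) (a : Fin d) : θ a = 0 := by
  by_contra h0
  have hrange := hS.range_eq_socle hV (hθ a) h0
  choose c hc using fun b => hS.exists_eq_smul (hθ a) (hθ b) (hS.injective (hθ a) h0)
    ((hS.range_le_socle (hθ b)).trans hrange.ge)
  have hc0 : c = 0 := by
    refine hψ.eq_zero c ?_
    rintro y ⟨hy, -⟩
    obtain ⟨x, rfl⟩ := hrange.ge hy
    rw [← h x]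
    refine Finset.sum_congr rfl fun b _ => ?_
    rw [hc b, LinearMap.smul_apply, map_smul, smul_eq_mul]
  exact h0 (by rw [hc a, hc0, Pi.zero_apply, zero_smul])

/-- Used for surjectivity. Carried over to `V` along `β`, the counit of `α` is a combination of the
`ψ b` on the degree-zero socle, so `α` is the same combination of the maps `V.ofFunctional (ψ b) ∘
β`. -/
theorem IsSocleDualBasis.range_le {d : ℕ} {ψ : Fin d → V.carrier →ₗ[k] k}
    (hψ : V.IsSocleDualBasis ψ) (hS : S.IsSimple) {β : S.carrier →ₗ[k] V.carrier}
    (hβ : S.IsHom V β) (h0 : β ≠ 0) {α : S.carrier →ₗ[k] (regular 𝒞).carrier}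
    (hα : S.IsHom (regular 𝒞) α) {R : Submodule k (regular 𝒞).carrier}
    (hR : ∀ b x, V.ofFunctional (ψ b) x ∈ R) (x : S.carrier) : α x ∈ R := by
  obtain ⟨l, hl⟩ := β.exists_leftInverse_of_injective (hS.ker_eq_bot hβ h0)
  obtain ⟨c, hc⟩ := hψ.exists_eq
    ((CoalgebraStruct.counit (R := k) (A := C) : (regular 𝒞).carrier →ₗ[k] k) ∘ₗ α ∘ₗ l)
  have hl' x : l (β x) = x := LinearMap.congr_fun hl x
  let α' : S.carrier →ₗ[k] (regular 𝒞).carrier := S.ofFunctional ((∑ b, c b • ψ b) ∘ₗ β)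
  have hker : S.gr 1 ≤ LinearMap.ker ((∑ b, c b • ψ b) ∘ₗ β) := fun y hy => by
    rw [LinearMap.mem_ker, LinearMap.comp_apply, LinearMap.sum_apply]
    refine Finset.sum_eq_zero fun b _ => ?_
    rw [LinearMap.smul_apply, LinearMap.mem_ker.1 (hψ.le_ker b (hβ.2 1 y hy)), smul_zero]
  have hα' : S.IsHom (regular 𝒞) α' := isHom_ofFunctional hker
  -- Counits suffice. They agree in degree zero by the choice of `c`, and in degree one both vanish
  -- because the maps are graded.
  have key : α = α' := by
    have h0 y (hy : y ∈ S.gr 0) : CoalgebraStruct.counit (R := k) (A := C) (α y) =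
        CoalgebraStruct.counit (R := k) (A := C) (α' y) := by
      have h1 := hc (β y) ⟨hS.range_le_socle hβ ⟨y, rfl⟩, hβ.2 0 y hy⟩
      refine (congrArg (fun z => CoalgebraStruct.counit (R := k) (A := C) (α z))
        (hl' y)).symm.trans (Eq.trans h1 ?_)
      refine Eq.symm ((counit_ofFunctional _ _).trans ?_)
      simp
    have h1 y (hy : y ∈ S.gr 1) : CoalgebraStruct.counit (R := k) (A := C) (α y) =
        CoalgebraStruct.counit (R := k) (A := C) (α' y) :=
      (hα.counit_eq_zero hy).trans (hα'.counit_eq_zero hy).symm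
    refine eq_of_counit_eq hα hα' fun y => ?_
    have e (γ : S.carrier →ₗ[k] (regular 𝒞).carrier) :
        CoalgebraStruct.counit (R := k) (A := C) (γ y) =
        CoalgebraStruct.counit (R := k) (A := C) (γ (S.proj 0 y)) +
        CoalgebraStruct.counit (R := k) (A := C) (γ (S.proj 1 y)) := by
      refine Eq.trans ?_ (map_add (CoalgebraStruct.counit (R := k) (A := C)) _ _)
      refine congrArg (CoalgebraStruct.counit (R := k) (A := C)) ?_
      exact (congrArg γ (S.proj_zero_add_one y)).symm.trans (map_add γ _ _)
    rw [e, e α', h0 _ (S.proj_mem 0 y), h1 _ (S.proj_mem 1 y)]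
  have hsum : α' x = ∑ b, c b • V.ofFunctional (ψ b) (β x) := by
    have h1 : S.ofFunctional ((∑ b, c b • ψ b) ∘ₗ β) =
        ∑ b, c b • (V.ofFunctional (ψ b) ∘ₗ β) := by
      refine eq_of_counit_eq (isHom_ofFunctional hker) ?_ fun y => ?_
      · refine Finset.sum_induction _ (S.IsHom (regular 𝒞)) (fun _ _ => IsHom.add)
          ⟨Comodule.isHom_iff.2 fun _ _ => (map_zero _).symm, fun _ _ _ => zero_mem _⟩
          fun b _ => ((isHom_ofFunctional (hψ.le_ker b)).comp hβ).smul _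
      · refine (counit_ofFunctional _ _).trans ?_
        rw [LinearMap.sum_apply, LinearMap.comp_apply, LinearMap.sum_apply]
        refine Eq.trans ?_ (map_sum (CoalgebraStruct.counit (R := k) (A := C)) _ _).symm
        refine Finset.sum_congr rfl fun b _ => ?_
        refine Eq.trans ?_ (map_smul (CoalgebraStruct.counit (R := k) (A := C)) (c b) _).symm
        exact congrArg (c b • ·) (counit_ofFunctional (ψ b) (β y)).symm
    refine (LinearMap.congr_fun h1 x).trans ?_
    rw [LinearMap.sum_apply]
    rfl
  rw [key, hsum]
  exact Submodule.sum_mem _ fun b _ => Submodule.smul_mem _ _ (hR b _)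

end dual

end GradedComodule

/-! ### The decomposition of the coalgebra -/

namespace GradedComodule

variable {k : Type u} [Field k] {C : Type v} [AddCommGroup C] [Module k C] [Coalgebra k C]
  {𝒞 : ZMod 2 → Submodule k C}

theorem gr_directSum_le {J : Type w'} {W : J → GradedComodule.{u, v, w} 𝒞} {n : ZMod 2}
    {P : Submodule k (directSum W).carrier} (h : ∀ j, ∀ x ∈ (W j).gr n, dsIncl W j x ∈ P) :
    (directSum W).gr n ≤ P := by
  refine iSup_le ?_
  rintro j _ ⟨x, hx, rfl⟩
  exact h j x hx

theorem map_eq_sum_dsProj {J : Type w'} {W : J → GradedComodule.{u, v, w} 𝒞}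
    {M : Type*} [AddCommGroup M] [Module k M] {F : (directSum W).carrier →ₗ[k] M}
    {f : ∀ j, (W j).carrier →ₗ[k] M} (hF : ∀ j x, F (dsIncl W j x) = f j x) {d : ℕ}
    {emb : Fin d → J} (hemb : Function.Injective emb) {x : (directSum W).carrier}
    (h : ∀ j, j ∉ Set.range emb → dsProj W j x = 0) :
    F x = ∑ b, f (emb b) (dsProj W (emb b) x) := by
  conv_lhs => rw [eq_sum_dsIncl hemb h, map_sum]
  exact Finset.sum_congr rfl fun b _ => hF _ _

theorem finrank_socle_reverse (V : GradedComodule.{u, v, w} 𝒞) :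
    Module.finrank k ↥(V.reverse.socle ⊓ V.reverse.gr 0) = V.socleDim 1 :=
  congrArg (fun N : Submodule k V.carrier => Module.finrank k ↥(N ⊓ V.gr 1)) socle_reverse

variable [IsGradedCoalgebra 𝒞]

theorem finrank_gr_ofSub {V : GradedComodule.{u, v, w} 𝒞} {N : Submodule k V.carrier}
    (hN : V.IsSub N) (n : ZMod 2) :
    Module.finrank k ((V.ofSub N hN).gr n) = Module.finrank k ↥(N ⊓ V.gr n) := by
  have : ((V.ofSub N hN).gr n).map (V.incl N hN) = N ⊓ V.gr n :=
    Submodule.map_comap_subtype N (V.gr n)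
  rw [← this]
  exact (Submodule.equivMapOfInjective _ (incl_injective hN) _).finrank_eq

theorem IsSimpleSub.finrank_eq_two_mul [IsAlgClosed k] {V : GradedComodule.{u, v, w} 𝒞}
    {S : Submodule k V.carrier} (hS : V.IsSimpleSub S) (h : ¬ V.IsAbsolutelySimpleSub S) :
    Module.finrank k S = 2 * Module.finrank k ↥(S ⊓ V.gr 0) := by
  have := hS.finite
  rw [hS.not_isAbsolutelySimpleSub_iff] at h
  have : Module.Finite k (V.ofSub S hS.1).carrier := hS.finite
  rw [← finrank_gr_ofSub hS.1]
  exact finrank_eq_of_iso_reverse h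

section family

variable {ι : Type w'} {I : ι → GradedComodule.{u, v, w} 𝒞}

theorem exists_isSocleDualBasis_summand [IsAlgClosed k]
    (hsoc : ∀ i, (I i).IsSimpleSub (I i).socle) :
    ∃ ψ : ∀ j : SummandIndex I, (summand I j).carrier →ₗ[k] k,
      (∀ i : Abs I, (I i.1).IsSocleDualBasis fun b => ψ (Sum.inl ⟨i, Sum.inl b⟩)) ∧
      (∀ i : Abs I, (I i.1).reverse.IsSocleDualBasis fun b => ψ (Sum.inl ⟨i, Sum.inr b⟩)) ∧
      ∀ i : NonAbs I, (I i.1).IsSocleDualBasis fun b => ψ (Sum.inr ⟨i, b⟩) := by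
  have hfin i : Module.Finite k (I i).socle := (hsoc i).finite
  have hfin' i : Module.Finite k (I i).reverse.socle :=
    (isSimpleSub_reverse_iff.2 (socle_reverse (V := I i) ▸ hsoc i :)).finite
  choose ψ₀ h₀ using fun i : Abs I => exists_isSocleDualBasis (V := I i.1) rfl
  choose ψ₁ h₁ using fun i : Abs I =>
    exists_isSocleDualBasis (V := (I i.1).reverse) (finrank_socle_reverse (I i.1))
  choose ψ₂ h₂ using fun i : NonAbs I => exists_isSocleDualBasis (V := I i.1)
    (d := Module.finrank k ↥(I i.1).socle / 2) (by
      rw [(hsoc i.1).finrank_eq_two_mul i.2]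
      simp)
  exact ⟨fun
    | Sum.inl ⟨i, Sum.inl b⟩ => ψ₀ i b
    | Sum.inl ⟨i, Sum.inr b⟩ => ψ₁ i b
    | Sum.inr ⟨i, b⟩ => ψ₂ i b, h₀, h₁, h₂⟩

theorem coactSplits_summand (h : ∀ i, (I i).CoactSplits) (j : SummandIndex I) :
    (summand I j).CoactSplits :=
  match j with
  | Sum.inl ⟨i, Sum.inl _⟩ => h i.1
  | Sum.inl ⟨i, Sum.inr _⟩ => (h i.1).reverse
  | Sum.inr ⟨i, _⟩ => h i.1

variable {S : GradedComodule.{u, v, w''} 𝒞}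

theorem IsCoverFamily.eq_of_iso {ι : Type w'} {I : ι → GradedComodule.{u, v, w} 𝒞}
    (hI : IsCoverFamily I) {i i' : ι}
    (h : S.toComodule.Iso ((I i).ofSub _ (hI.socle_simple i).1).toComodule)
    (h' : S.toComodule.Iso ((I i').ofSub _ (hI.socle_simple i').1).toComodule) : i = i' := by
  refine (hI.existsUnique ((I i).ofSub _ (hI.socle_simple i).1)
    (isSimple_ofSub (hI.socle_simple i))).unique ?_ ?_
  · exact (isoSub_iff (hI.socle_simple i).1).2 ⟨LinearEquiv.refl k _, isHom_id.1⟩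
  · exact (isoSub_iff (hI.socle_simple i').1).2 (h.symm.trans h')

theorem IsSimple.iso_reverse_ofSub_socle {V : GradedComodule.{u, v, w} 𝒞} (hS : S.IsSimple)
    (hV : V.IsSimpleSub V.socle) {θ : S.carrier →ₗ[k] V.carrier} (hθ : S.IsHom V.reverse θ)
    (h0 : θ ≠ 0) : S.reverse.Iso (V.ofSub V.socle hV.1) :=
  hS.reverse.iso_ofSub_socle hV (V.reverse_reverse_isHom.comp hθ.reverse) h0

/-- A nonzero kernel would contain a simple `S`. All nonzero components of its inclusion into the
sum lie in a single block of equal summands, and there `IsSocleDualBasis.hom_eq_zero` applies. -/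
theorem IsCoverFamily.injective_ofFunctional [IsAlgClosed k] (hI : IsCoverFamily I)
    {ψ : ∀ j : SummandIndex I, (summand I j).carrier →ₗ[k] k}
    (h₀ : ∀ i : Abs I, (I i.1).IsSocleDualBasis fun b => ψ (Sum.inl ⟨i, Sum.inl b⟩))
    (h₁ : ∀ i : Abs I, (I i.1).reverse.IsSocleDualBasis fun b => ψ (Sum.inl ⟨i, Sum.inr b⟩))
    (h₂ : ∀ i : NonAbs I, (I i.1).IsSocleDualBasis fun b => ψ (Sum.inr ⟨i, b⟩))
    {Ψ : (decomposition I).carrier →ₗ[k] k}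
    (hΨ : ∀ j x, Ψ (dsIncl (summand I) j x) = ψ j x)
    (hker : (decomposition I).gr 1 ≤ LinearMap.ker Ψ) :
    Function.Injective ((decomposition I).ofFunctional Ψ) := by
  have hsoc := hI.socle_simple
  have hΦ := isHom_ofFunctional hker
  refine LinearMap.ker_eq_bot.1 ?_
  by_contra hne
  obtain ⟨X, hXK, hX, -⟩ := exists_isSimpleSub_le hΦ.isSub_ker hne
  have hS := isSimple_ofSub hX
  let S := (decomposition I).ofSub X hX.1
  let θ (j : SummandIndex I) : S.carrier →ₗ[k] (summand I j).carrier :=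
    dsProj (summand I) j ∘ₗ (decomposition I).incl X hX.1
  have hθ j : S.IsHom (summand I j) (θ j) := (isHom_dsProj j).comp (isHom_incl hX.1)
  -- `Ψ` is the counit of the map it induces, so it vanishes on the kernel.
  have hzero (x : S.carrier) : Ψ ((decomposition I).incl X hX.1 x) = 0 := by
    have h0 : (decomposition I).ofFunctional Ψ ((decomposition I).incl X hX.1 x) = 0 := hXK x.2
    rw [← counit_ofFunctional, h0]
    exact map_zero _
  have hsum {d : ℕ} {emb : Fin d → SummandIndex I} (hemb : Function.Injective emb)
      (h : ∀ j, θ j ≠ 0 → j ∈ Set.range emb) (x : S.carrier) :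
      ∑ b, ψ (emb b) (θ (emb b) x) = 0 := by
    rw [← hzero x]
    refine (map_eq_sum_dsProj hΨ hemb fun j hj => ?_).symm
    exact LinearMap.congr_fun (of_not_not fun h0 => hj (h j h0) : θ j = 0) x
  have iso₀ (i : Abs I) b (h : θ (Sum.inl ⟨i, Sum.inl b⟩) ≠ 0) :
      S.Iso ((I i.1).ofSub _ (hsoc i.1).1) :=
    hS.iso_ofSub_socle (hsoc i.1) (hθ (Sum.inl ⟨i, Sum.inl b⟩)) h
  have iso₁ (i : Abs I) b (h : θ (Sum.inl ⟨i, Sum.inr b⟩) ≠ 0) :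
      S.reverse.Iso ((I i.1).ofSub _ (hsoc i.1).1) :=
    hS.iso_reverse_ofSub_socle (hsoc i.1) (hθ (Sum.inl ⟨i, Sum.inr b⟩)) h
  have iso₂ (i : NonAbs I) b (h : θ (Sum.inr ⟨i, b⟩) ≠ 0) :
      S.Iso ((I i.1).ofSub _ (hsoc i.1).1) :=
    hS.iso_ofSub_socle (hsoc i.1) (hθ (Sum.inr ⟨i, b⟩)) h
  -- An absolutely simple socle differs from its reverse, so `S` cannot have components both in
  -- copies of `I i` and in copies of its reverse.
  have abs₀₁ (i : Abs I) (h : S.Iso ((I i.1).ofSub _ (hsoc i.1).1))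
      (h' : S.reverse.Iso ((I i.1).ofSub _ (hsoc i.1).1)) : False :=
    (hsoc i.1).not_isAbsolutelySimpleSub_iff.2 (h.symm.trans h'.reverse_right) i.2
  obtain ⟨j, hj⟩ : ∃ j, θ j ≠ 0 := by
    by_contra! h
    refine hS.ne_bot (eq_bot_iff.2 fun x _ => incl_injective hX.1 (directSum_ext fun j => ?_))
    exact (LinearMap.congr_fun (h j) x).trans (map_zero _).symm
  match j with
  | Sum.inl ⟨i, Sum.inl a⟩ =>
    have hi := iso₀ i a hj
    refine hj ((h₀ i).hom_eq_zero (hsoc i.1) hS (θ := fun b => θ (Sum.inl ⟨i, Sum.inl b⟩))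
      (fun b => hθ (Sum.inl ⟨i, Sum.inl b⟩))
      (hsum (emb := fun b => Sum.inl ⟨i, Sum.inl b⟩) ?_ fun j' hj' => ?_) a)
    · intro b b' h
      simpa using h
    · match j' with
      | Sum.inl ⟨i', Sum.inl b⟩ =>
        obtain rfl : i = i' :=
          Subtype.ext (hI.eq_of_iso hi.toComodule (iso₀ i' b hj').toComodule)
        exact ⟨b, rfl⟩
      | Sum.inl ⟨i', Sum.inr b⟩ =>
        obtain rfl : i = i' :=
          Subtype.ext (hI.eq_of_iso hi.toComodule (iso₁ i' b hj').toComodule)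
        exact (abs₀₁ i hi (iso₁ i b hj')).elim
      | Sum.inr ⟨i', b⟩ =>
        have e := hI.eq_of_iso hi.toComodule (iso₂ i' b hj').toComodule
        exact absurd (e ▸ i.2) i'.2
  | Sum.inl ⟨i, Sum.inr a⟩ =>
    have hi := iso₁ i a hj
    have hV : (I i.1).reverse.IsSimpleSub (I i.1).reverse.socle :=
      isSimpleSub_reverse_iff.2 (socle_reverse (V := I i.1) ▸ hsoc i.1 :)
    refine hj ((h₁ i).hom_eq_zero hV hS (θ := fun b => θ (Sum.inl ⟨i, Sum.inr b⟩))
      (fun b => hθ (Sum.inl ⟨i, Sum.inr b⟩))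
      (hsum (emb := fun b => Sum.inl ⟨i, Sum.inr b⟩) ?_ fun j' hj' => ?_) a)
    · intro b b' h
      simpa using h
    · match j' with
      | Sum.inl ⟨i', Sum.inl b⟩ =>
        obtain rfl : i = i' :=
          Subtype.ext (hI.eq_of_iso (S := S) hi.toComodule (iso₀ i' b hj').toComodule)
        exact (abs₀₁ i (iso₀ i b hj') hi).elim
      | Sum.inl ⟨i', Sum.inr b⟩ =>
        obtain rfl : i = i' :=
          Subtype.ext (hI.eq_of_iso hi.toComodule (iso₁ i' b hj').toComodule)
        exact ⟨b, rfl⟩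
      | Sum.inr ⟨i', b⟩ =>
        have e := hI.eq_of_iso (S := S) hi.toComodule (iso₂ i' b hj').toComodule
        exact absurd (e ▸ i.2) i'.2
  | Sum.inr ⟨i, a⟩ =>
    have hi := iso₂ i a hj
    refine hj ((h₂ i).hom_eq_zero (hsoc i.1) hS (θ := fun b => θ (Sum.inr ⟨i, b⟩))
      (fun b => hθ (Sum.inr ⟨i, b⟩)) (hsum (emb := fun b => Sum.inr ⟨i, b⟩) ?_ fun j' hj' => ?_) a)
    · intro b b' h
      simpa using h
    · match j' with
      | Sum.inl ⟨i', Sum.inl b⟩ =>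
        have e := hI.eq_of_iso hi.toComodule (iso₀ i' b hj').toComodule
        exact absurd (e ▸ i'.2) i.2
      | Sum.inl ⟨i', Sum.inr b⟩ =>
        have e := hI.eq_of_iso hi.toComodule (iso₁ i' b hj').toComodule
        exact absurd (e ▸ i'.2) i.2
      | Sum.inr ⟨i', b⟩ =>
        obtain rfl : i = i' :=
          Subtype.ext (hI.eq_of_iso hi.toComodule (iso₂ i' b hj').toComodule)
        exact ⟨b, rfl⟩

end family

theorem IsCoverFamily.exists_hom {ι : Type w'} {I : ι → GradedComodule.{u, v, v} 𝒞}
    (hI : IsCoverFamily I) {S : GradedComodule.{u, v, v} 𝒞} (hS : S.IsSimple) :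
    ∃ i, S.Iso ((I i).ofSub _ (hI.socle_simple i).1) ∨
      S.Iso ((I i).ofSub _ (hI.socle_simple i).1).reverse := by
  obtain ⟨i, hi, -⟩ := hI.existsUnique S hS
  exact ⟨i, hS.iso_or_iso_reverse (isSimple_ofSub (hI.socle_simple i))
    ((isoSub_iff (hI.socle_simple i).1).1 hi)⟩

/-- The injective map from the sum to `C` has a retraction `g`, the sum being injective. A simple
subcomodule in the kernel of `g` would also lie in the image of the map, on which `g` is injective.
-/
theorem IsCoverFamily.regular_iso_decomposition [IsAlgClosed k] {ι : Type w'}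
    {I : ι → GradedComodule.{u, v, v} 𝒞} (hI : IsCoverFamily I) :
    (regular 𝒞).Iso (decomposition I) := by
  have hsoc := hI.socle_simple
  obtain ⟨ψ, h₀, h₁, h₂⟩ := exists_isSocleDualBasis_summand hsoc
  obtain ⟨Ψ, hΨ⟩ := exists_directSum_lift ψ
  have hψker : ∀ j, (summand I j).gr 1 ≤ LinearMap.ker (ψ j) := fun
    | Sum.inl ⟨i, Sum.inl b⟩ => (h₀ i).le_ker b
    | Sum.inl ⟨i, Sum.inr b⟩ => (h₁ i).le_ker b
    | Sum.inr ⟨i, b⟩ => (h₂ i).le_ker b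
  have hker : (decomposition I).gr 1 ≤ LinearMap.ker Ψ := gr_directSum_le fun j x hx => by
    rw [LinearMap.mem_ker, hΨ]
    exact hψker j hx
  have hΦ := isHom_ofFunctional hker
  have hinj := hI.injective_ofFunctional h₀ h₁ h₂ hΨ hker
  have hrange j x :
      (summand I j).ofFunctional (ψ j) x ∈ LinearMap.range ((decomposition I).ofFunctional Ψ) := by
    have : (summand I j).ofFunctional (ψ j) =
        (decomposition I).ofFunctional Ψ ∘ₗ dsIncl (summand I) j := by
      refine eq_of_counit_eq (isHom_ofFunctional (hψker j)) (hΦ.comp (isHom_dsIncl j)) fun y => ?_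
      exact (counit_ofFunctional _ _).trans
        ((hΨ j y).symm.trans (counit_ofFunctional (V := decomposition I) _ _).symm)
    rw [this]
    exact ⟨_, rfl⟩
  have hsplit : (decomposition I).CoactSplits :=
    CoactSplits.directSum (coactSplits_summand fun i => (hI.injective i).coactSplits)
  obtain ⟨g, hg, hgx⟩ := hsplit.exists_extension hΦ hinj isHom_id
  refine hg.iso ⟨LinearMap.ker_eq_bot.1 ?_, fun x => ⟨_, hgx x⟩⟩
  by_contra hne
  obtain ⟨X, hXK, hX, -⟩ := exists_isSimpleSub_le hg.isSub_ker hne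
  have hS := isSimple_ofSub hX
  have hα := isHom_incl hX.1
  suffices h : ∀ x, (regular 𝒞).incl X hX.1 x ∈
      LinearMap.range ((decomposition I).ofFunctional Ψ) by
    refine hS.ne_bot (eq_bot_iff.2 fun x _ => incl_injective hX.1 ?_)
    obtain ⟨y, hy⟩ := h x
    have h1 : g ((regular 𝒞).incl X hX.1 x) = 0 := hXK x.2
    rw [← hy, hgx, LinearMap.id_apply] at h1
    rw [← hy, h1, map_zero, map_zero]
  have even (i) {d : ℕ} {φ : Fin d → (I i).carrier →ₗ[k] k} (hφ : (I i).IsSocleDualBasis φ)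
      (hR : ∀ b x, (I i).ofFunctional (φ b) x ∈
        LinearMap.range ((decomposition I).ofFunctional Ψ))
      (h : ((regular 𝒞).ofSub X hX.1).Iso ((I i).ofSub _ (hsoc i).1)) :
      ∀ x, (regular 𝒞).incl X hX.1 x ∈ LinearMap.range ((decomposition I).ofFunctional Ψ) := by
    obtain ⟨e, he⟩ := h
    refine hφ.range_le hS ((isHom_incl (hsoc i).1).comp he) (fun h0 => ?_) hα hR
    refine hS.ne_bot (eq_bot_iff.2 fun x _ => e.injective (incl_injective (hsoc i).1 ?_))
    rw [map_zero, map_zero]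
    exact LinearMap.congr_fun h0 x
  obtain ⟨i, hi | hi⟩ := hI.exists_hom hS
  · by_cases habs : (I i).IsAbsolutelySimpleSub (I i).socle
    · exact even i (h₀ ⟨i, habs⟩) (fun b => hrange (Sum.inl ⟨⟨i, habs⟩, Sum.inl b⟩)) hi
    · exact even i (h₂ ⟨i, habs⟩) (fun b => hrange (Sum.inr ⟨⟨i, habs⟩, b⟩)) hi
  · by_cases habs : (I i).IsAbsolutelySimpleSub (I i).socle
    · obtain ⟨e, he⟩ := hi
      refine (h₁ ⟨i, habs⟩).range_le hS ((isHom_incl (hsoc i).1).reverse.comp he) (fun h0 => ?_) hα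
        fun b => hrange (Sum.inl ⟨⟨i, habs⟩, Sum.inr b⟩)
      refine hS.ne_bot (eq_bot_iff.2 fun x _ => e.injective (incl_injective (hsoc i).1 ?_))
      refine Eq.trans (LinearMap.congr_fun h0 x) ?_
      rw [map_zero]
      exact (map_zero ((I i).incl _ (hsoc i).1)).symm
    -- Here the socle is isomorphic to its reverse, so no reversed copies are needed.
    · exact even i (h₂ ⟨i, habs⟩) (fun b => hrange (Sum.inr ⟨⟨i, habs⟩, b⟩))
        (hi.trans ((hsoc i).not_isAbsolutelySimpleSub_iff.1 habs).symm)

end GradedComodule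

theorem proposition1 {k : Type u} [Field k] [IsAlgClosed k] {C : Type v} [AddCommGroup C]
    [Module k C] [Coalgebra k C] (𝒞 : ZMod 2 → Submodule k C) [IsGradedCoalgebra 𝒞] :
    -- families of injective covers exist, with gradings for which each is contained in `C`
    (∃ (ι : Type v) (I : ι → GradedComodule.{u, v, v} 𝒞),
      GradedComodule.IsCoverFamily I ∧ ∀ i, (I i).Embeds (GradedComodule.regular 𝒞)) ∧
    -- for every such family the multiplicities are natural numbers, and `C` decomposes
    (∀ (ι : Type w) (I : ι → GradedComodule.{u, v, v} 𝒞), GradedComodule.IsCoverFamily I →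
      (∀ i, Module.Finite k ↥(I i).socle) ∧
      (∀ i, ¬ (I i).IsAbsolutelySimpleSub (I i).socle →
        Even (Module.finrank k ↥(I i).socle)) ∧
      (GradedComodule.regular 𝒞).Iso (GradedComodule.decomposition I)) ∧
    -- an indecomposable injective has exactly two gradings, which are reverse to each other
    (∀ I : GradedComodule.{u, v, v} 𝒞, I.IsIndecomposable → I.IsInjective →
      I.reverse.gr ≠ I.gr ∧
      (∀ J : GradedComodule.{u, v, v} 𝒞, I.toComodule.Iso J.toComodule →
        J.Iso I ∨ J.Iso I.reverse) ∧
      (I.Iso I.reverse ↔ ¬ I.IsAbsolutelySimpleSub I.socle)) := by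
  refine ⟨GradedComodule.exists_isCoverFamily 𝒞, fun ι I hI => ⟨fun i => (hI.socle_simple i).finite,
    fun i hi => ?_, hI.regular_iso_decomposition⟩, fun I hI hinj => ?_⟩
  · rw [(hI.socle_simple i).finrank_eq_two_mul hi]
    exact even_two_mul _
  · have := hI.1
    obtain ⟨hS, hess⟩ := hI.socle hinj.coactSplits
    exact ⟨GradedComodule.gr_reverse_ne, fun J hJ => hess.iso_or_iso_reverse hS hinj hJ,
      hess.iso_reverse_iff hS hinj⟩
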